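/- **Proposition 2.1.** Fix an integer $q\ge 1$. For a finite multigraph $G=(V,E)$ (loops and parallel edges allowed) and $\beta>0$ let $$Z_\beta(G)=\sum_{\sigma\in[q]^V}\ \prod_{vw\in E}\Bigl(1-(1-e^{-\beta})\mathbf 1\{\sigma(v)=\sigma(w)\}\Bigr)$$ be the partition function of the $q$-spin Potts antiferromagnet on $G$, each edge being counted with its multiplicity. Let $\mathbb G$ be one of the following random graphs with $n$ labelled vertices, and let $\boldsymbol G$ be the associated sparsified random multigraph with parameter $\varepsilon\in(0,1]$: * *Binomial case* ($d>0$ a fixed real number): $\mathbb G=\mathbb G(n,d/n)$ is the binomial random graph, and $\boldsymbol G$ consists of $\boldsymbol m$ independent edges, each chosen uniformly out of all $\binom n2$ possible edges. * *Regular case* ($d\ge 1$ a fixed integer): $\mathbb G=\mathbb G(n,d)$ is a uniformly random simple $d$-regular graph (for $dn$ even), and $\boldsymbol G$ is obtained by choosing a uniformly random matching of size $\boldsymbol m$ of the complete graph on $[n]\times[d]$ and inserting one $vw$-edge for every matching edge $\{(v,i),(w,j)\}$. In both cases $\boldsymbol m$ is a Poisson variable of mean $(1-\varepsilon)dn/2$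 conditioned on not exceeding $dn/2$. Then in either case, for any $\varepsilon\in(0,1]$ and any $\delta,\beta>0$ there is $\xi>0$ (which may depend on $q,d,\varepsilon,\delta,\beta$, but not on $n$) such that for all large enough $n$ $$\Pr\Bigl[\bigl|\log Z_\beta(\mathbb G)-\mathbb E[\log Z_\beta(\mathbb G)]\bigr|>\delta n\Bigr]\le e^{-\xi n},\qquad \Pr\Bigl[\bigl|\log Z_\beta(\boldsymbol G)-\mathbb E[\log Z_\beta(\boldsymbol G)]\bigr|>\delta n\Bigr]\le e^{-\xi n},$$ where in the regular case the first inequality is claimed for those large $n$ for which $dn$ is even. -/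

import Mathlib

open MeasureTheory ProbabilityTheory Filter
open scoped ENNReal

/-- A multigraph on the vertex set `V`: a finite multiset of undirected edges. Loops and parallel
edges are allowed; the multiplicity of an edge is its multiplicity in the multiset. -/
structure Multigraph (V : Type*) where
  edges : Multiset (Sym2 V)

/-- Every set of multigraphs is an event. -/
instance (V : Type*) : MeasurableSpace (Multigraph V) := ⊤

instance (V : Type*) : DiscreteMeasurableSpace (Multigraph V) := ⟨fun _ => trivial⟩

/-- A finite simple graph, viewed as a multigraph. -/
noncomputable def SimpleGraph.toMultigraph {V : Type*} [Finite V] (G : SimpleGraph V) :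
    Multigraph V :=
  ⟨G.edgeSet.toFinite.toFinset.val⟩

open Classical in
/-- The factor `1 - (1 - exp (-β)) 𝟙{σ v = σ w}` that the edge `e = vw` contributes. The pair
`{σ v, σ w}` is on the diagonal exactly if `σ v = σ w`. -/
noncomputable def edgeWeight {V : Type*} {q : ℕ} (β : ℝ) (σ : V → Fin q) (e : Sym2 V) : ℝ :=
  1 - (1 - Real.exp (-β)) * (if (e.map σ).IsDiag then 1 else 0)

open Classical in
/-- The partition function `Z_β(G)` of the `q`-spin Potts antiferromagnet on the multigraph `G` at
inverse temperature `β`. -/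
noncomputable def Multigraph.partitionFunction {V : Type*} [Fintype V] (q : ℕ) (β : ℝ)
    (G : Multigraph V) : ℝ :=
  ∑ σ : V → Fin q, (G.edges.map (edgeWeight β σ)).prod

/-- The random variable `log Z_β(G)` on multigraphs. -/
noncomputable def Multigraph.logZ {V : Type*} [Fintype V] (q : ℕ) (β : ℝ) (G : Multigraph V) : ℝ :=
  Real.log (G.partitionFunction q β)

/-- The probability under `μ` that the random variable `X` differs from its mean by more
than `t`. -/
noncomputable def deviationProb {Ω : Type*} [MeasurableSpace Ω] (μ : Measure Ω) (X : Ω → ℝ)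
    (t : ℝ) : ℝ :=
  μ.real {ω | |X ω - ∫ ω', X ω' ∂μ| > t}

/-- The law of the binomial random graph `G(n, d/n)`. The edge probability is `d/n`, cut off
at `1` for those finitely many `n` with `n < d`. -/
noncomputable def binomialGraph (d : ℝ) (n : ℕ) : Measure (SimpleGraph (Fin n)) :=
  SimpleGraph.binomialRandom (Fin n) (Set.projIcc (0 : ℝ) 1 zero_le_one (d / n))

open Classical in
/-- The law of the random regular graph `G(n, d)`: the uniform distribution on the simple
`d`-regular graphs with `n` labelled vertices. -/
noncomputable def regularGraph (d n : ℕ) : Measure (SimpleGraph (Fin n)) :=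
  uniformOn {G : SimpleGraph (Fin n) | G.IsRegularOfDegree d}

/-- The law of `f a`, for `a` chosen uniformly at random from the nonempty finite set `s`. -/
noncomputable def uniformLaw {α Ω : Type*} [MeasurableSpace Ω] (s : Finset α) (f : α → Ω) :
    Measure Ω :=
  (s.card : ℝ≥0∞)⁻¹ • ∑ a ∈ s, Measure.dirac (f a)

/-- The law of the number of edges of the sparsified multigraphs: a Poisson variable
of mean `(1 - ε) d n / 2`, conditioned on not exceeding `d n / 2`. -/
noncomputable def edgeNumber (ε d : ℝ) (n : ℕ) : Measure ℕ :=
  cond (poissonMeasure ((1 - ε) * d * n / 2).toNNReal) {m : ℕ | (m : ℝ) ≤ d * n / 2}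

open Classical in
/-- The law of the multigraph with vertex set `Fin n` and `m` independent edges, each of them
uniform among the `n.choose 2` pairs of distinct vertices. -/
noncomputable def independentEdges (n m : ℕ) : Measure (Multigraph (Fin n)) :=
  uniformLaw (Fintype.piFinset fun _ : Fin m => {e : Sym2 (Fin n) | ¬ e.IsDiag})
    (fun e => ⟨Finset.univ.val.map e⟩)

/-- The law of the sparsified multigraph of the binomial random graph: `m` independent uniformly
random edges, with a random number `m` of edges distributed as `edgeNumber ε d n`. -/
noncomputable def sparsifiedBinomial (ε d : ℝ) (n : ℕ) : Measure (Multigraph (Fin n)) :=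
  (edgeNumber ε d n).bind (independentEdges n)

open Classical in
/-- The matchings of size `m` of the complete graph on `X`, as sets of pairwise
disjoint edges. -/
noncomputable def matchings (X : Type*) [Fintype X] (m : ℕ) : Finset (Finset (Sym2 X)) :=
  {M | M.card = m ∧ (∀ e ∈ M, ¬ e.IsDiag) ∧ ∀ e ∈ M, ∀ f ∈ M, e ≠ f → ∀ x ∈ e, x ∉ f}

/-- The law of the multigraph obtained from a uniformly random matching of size `m` of the complete
graph on `Fin n × Fin d`, by inserting one `vw`-edge for every matching
edge `{(v, i), (w, j)}`. -/
noncomputable def configurationModel (d n m : ℕ) : Measure (Multigraph (Fin n)) :=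
  uniformLaw (matchings (Fin n × Fin d) m) (fun M => ⟨M.val.map (Sym2.map Prod.fst)⟩)

/-- The law of the sparsified multigraph of the random regular graph: the configuration model with
a random number of matching edges distributed as `edgeNumber ε d n`. -/
noncomputable def sparsifiedRegular (ε : ℝ) (d n : ℕ) : Measure (Multigraph (Fin n)) :=
  (edgeNumber ε d n).bind (configurationModel d n)

/-!
Changing one edge changes `log Z` by at most `β`, so the method of bounded differences bounds the
centred moment generating function of `log Z` at `t` by `exp (O(t² n))`, for `t` in a fixed window.
For the binomial graph the variables are the edge indicators, whose total variance is `O(n)`. For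
the multigraphs with a fixed number `m` of edges they are the independent edges, or the values of a
uniformly random permutation of the half-edges. The conditional mean of `log Z` given `m` is
Lipschitz in `m`, so the Poisson variable contributes one more factor of the same kind, and
Chernoff's bound applies.

The random regular graph has the law of the configuration model conditioned on being simple, so a
polynomial lower bound for the probability of simplicity transfers the concentration. By the first
moment method, at least half of the pairings have only boundedly many half-edges on loops and
multiple edges. These can be switched away one at a time, and each pairing is reached from only
polynomially many others.
-/

section BoundedVariables

variable {Ω : Type*} [MeasurableSpace Ω] {μ : Measure Ω} {X : Ω → ℝ} {r : ℝ}

lemma integrable_of_integrable_exp_mul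
    (h : ∀ t : ℝ, |t| * r ≤ 1 → Integrable (fun ω => Real.exp (t * X ω)) μ) : Integrable X μ := by
  refine integrable_of_mem_interior_integrableExpSet (mem_interior_iff_mem_nhds.2 ?_)
  have hlim : Tendsto (fun t : ℝ => |t| * r) (nhds 0) (nhds 0) :=
    (by fun_prop : Continuous fun t : ℝ => |t| * r).tendsto' _ _ (by simp)
  filter_upwards [hlim.eventually_le_const one_pos] with t ht using h t ht

variable [IsProbabilityMeasure μ]

lemma integrable_of_abs_sub_le (hX : Measurable X) (hosc : ∀ x y, |X x - X y| ≤ r) :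
    Integrable X μ := by
  obtain ⟨x₀⟩ := μ.nonempty_of_neZero
  refine .of_bound hX.aestronglyMeasurable (|X x₀| + r) (ae_of_all μ fun x => ?_)
  rw [Real.norm_eq_abs]
  linarith [hosc x x₀, abs_sub_abs_le_abs_sub (X x) (X x₀)]

lemma abs_integral_sub_integral_le {Y : Ω → ℝ} (hX : Integrable X μ) (hY : Integrable Y μ)
    (h : ∀ ω, |X ω - Y ω| ≤ r) : |μ[X] - μ[Y]| ≤ r := by
  rw [← integral_sub hX hY]
  simpa using norm_integral_le_of_norm_le_const (μ := μ) (f := fun ω => X ω - Y ω)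
    (ae_of_all μ h)

lemma abs_sub_integral_le (hX : Measurable X) (hosc : ∀ x y, |X x - X y| ≤ r) (x : Ω) :
    |X x - μ[X]| ≤ r := by
  simpa using abs_integral_sub_integral_le (μ := μ) (integrable_const (X x))
    (integrable_of_abs_sub_le hX hosc) (hosc x)

lemma mgf_le_exp_of_abs_le (hX : Measurable X) (hbound : ∀ x, |X x| ≤ r) (hmean : μ[X] = 0)
    {t : ℝ} (ht : |t| * r ≤ 1) : mgf X μ t ≤ Real.exp (t ^ 2 * ∫ ω, X ω ^ 2 ∂μ) := by
  have hexp (x) : Real.exp (t * X x) ≤ t ^ 2 * X x ^ 2 + (t * X x + 1) := by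
    have habs : |t * X x| ≤ 1 := by
      rw [abs_mul]
      exact (mul_le_mul_of_nonneg_left (hbound x) (abs_nonneg t)).trans ht
    linarith [(abs_le.1 (Real.abs_exp_sub_one_sub_id_le habs)).2, mul_pow t (X x) 2]
  have hint : Integrable (fun x => t * X x) μ :=
    (Integrable.of_bound hX.aestronglyMeasurable r (ae_of_all μ hbound)).const_mul t
  have hint_sq : Integrable (fun x => t ^ 2 * X x ^ 2) μ := by
    refine .const_mul (.of_bound (by fun_prop) (r ^ 2) (ae_of_all μ fun x => ?_)) _
    rw [Real.norm_eq_abs, abs_pow]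
    exact pow_le_pow_left₀ (abs_nonneg _) (hbound x) 2
  have hint_lin : Integrable (fun x => t * X x + 1) μ := hint.add (integrable_const 1)
  calc mgf X μ t ≤ ∫ x, (t ^ 2 * X x ^ 2 + (t * X x + 1)) ∂μ :=
        integral_mono_of_nonneg (ae_of_all μ fun x => Real.exp_nonneg _) (hint_sq.add hint_lin)
          (ae_of_all μ hexp)
    _ = t ^ 2 * ∫ x, X x ^ 2 ∂μ + 1 := by
        rw [integral_add hint_sq hint_lin, integral_add hint (integrable_const 1),
          integral_const_mul, integral_const_mul, hmean]
        simp
    _ ≤ Real.exp (t ^ 2 * ∫ ω, X ω ^ 2 ∂μ) := Real.add_one_le_exp _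

end BoundedVariables

section LipschitzImage

lemma abs_mul_sub_le_of_abs_sub_le_mul {α : Type*} {X Y : α → ℝ} {t C : ℝ}
    (hYX : ∀ x y, |Y x - Y y| ≤ C * |X x - X y|) (x y : α) :
    |t * (Y x - Y y)| ≤ |t * C * (X x - X y)| := by
  rw [mul_assoc, abs_mul, abs_mul]
  refine mul_le_mul_of_nonneg_left ?_ (abs_nonneg t)
  calc |Y x - Y y| ≤ C * |X x - X y| := hYX x y
    _ ≤ |C| * |X x - X y| := by gcongr; exact le_abs_self C
    _ = |C * (X x - X y)| := (abs_mul _ _).symm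

variable {Ω : Type*} [MeasurableSpace Ω] {μ : Measure Ω} {X Y : Ω → ℝ}
  {t C : ℝ}

lemma exp_mul_integral_le_mgf [IsProbabilityMeasure μ] (hX : Integrable X μ)
    (ht : Integrable (fun ω => Real.exp (t * X ω)) μ) : Real.exp (t * μ[X]) ≤ mgf X μ t := by
  rw [← integral_const_mul]
  exact convexOn_exp.map_integral_le Real.continuous_exp.continuousOn isClosed_univ
    (ae_of_all μ fun _ => Set.mem_univ _) (hX.const_mul t) ht

lemma integrable_exp_mul_of_abs_sub_le_mul [IsProbabilityMeasure μ] (hY : Measurable Y)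
    (hYX : ∀ x y, |Y x - Y y| ≤ C * |X x - X y|)
    (hpos : Integrable (fun ω => Real.exp (t * C * X ω)) μ)
    (hneg : Integrable (fun ω => Real.exp (-(t * C) * X ω)) μ) :
    Integrable (fun ω => Real.exp (t * Y ω)) μ := by
  obtain ⟨x₀⟩ := μ.nonempty_of_neZero
  refine (((hpos.mul_const (Real.exp (-(t * C) * X x₀))).add
    (hneg.mul_const (Real.exp (t * C * X x₀)))).const_mul (Real.exp (t * Y x₀))).mono'
    (by fun_prop) (ae_of_all μ fun x => ?_)
  have hle : t * (Y x - Y x₀) ≤ |t * C * (X x - X x₀)| :=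
    (le_abs_self _).trans (abs_mul_sub_le_of_abs_sub_le_mul hYX x x₀)
  calc ‖Real.exp (t * Y x)‖ = Real.exp (t * Y x₀) * Real.exp (t * (Y x - Y x₀)) := by
        rw [Real.norm_eq_abs, Real.abs_exp, ← Real.exp_add]; ring_nf
    _ ≤ Real.exp (t * Y x₀) *
          (Real.exp (t * C * (X x - X x₀)) + Real.exp (-(t * C * (X x - X x₀)))) := by
        gcongr
        exact (Real.exp_le_exp.2 hle).trans (Real.exp_abs_le _)
    _ = _ := by
        simp only [Pi.add_apply, ← Real.exp_add]; ring_nf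

lemma cosh_mul_sub_eq (s x y : ℝ) : Real.cosh (s * (x - y)) =
    (Real.exp (s * x) * Real.exp (-s * y) + Real.exp (-s * x) * Real.exp (s * y)) / 2 := by
  rw [Real.cosh_eq, ← Real.exp_add, ← Real.exp_add]
  ring_nf

lemma integrable_cosh_mul_sub (h : Integrable (fun ω => Real.exp (t * X ω)) μ)
    (h' : Integrable (fun ω => Real.exp (-t * X ω)) μ) :
    Integrable (fun p : Ω × Ω => Real.cosh (t * (X p.1 - X p.2))) (μ.prod μ) := by
  simp only [cosh_mul_sub_eq]
  exact ((h.mul_prod h').add (h'.mul_prod h)).div_const 2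

lemma integral_cosh_mul_sub [SFinite μ] (h : Integrable (fun ω => Real.exp (t * X ω)) μ)
    (h' : Integrable (fun ω => Real.exp (-t * X ω)) μ) :
    ∫ p : Ω × Ω, Real.cosh (t * (X p.1 - X p.2)) ∂(μ.prod μ) = mgf X μ t * mgf X μ (-t) := by
  have hprod (a b : ℝ) : ∫ p : Ω × Ω, Real.exp (a * X p.1) * Real.exp (b * X p.2) ∂(μ.prod μ) =
      mgf X μ a * mgf X μ b :=
    integral_prod_mul (fun ω => Real.exp (a * X ω)) fun ω => Real.exp (b * X ω)
  simp only [cosh_mul_sub_eq]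
  rw [integral_div, integral_add (h.mul_prod h') (h'.mul_prod h), hprod, hprod]
  ring

/-- Symmetrisation: the left-hand side is `𝔼 exp (t (Y - Y')) = 𝔼 cosh (t (Y - Y'))` for an
independent copy `Y'` of `Y`, and `cosh` is increasing in the absolute value of its argument. -/
lemma mgf_mul_mgf_neg_le_of_abs_sub_le_mul [SFinite μ] (hYX : ∀ x y, |Y x - Y y| ≤ C * |X x - X y|)
    (hY : Integrable (fun ω => Real.exp (t * Y ω)) μ)
    (hY' : Integrable (fun ω => Real.exp (-t * Y ω)) μ)
    (hX : Integrable (fun ω => Real.exp (t * C * X ω)) μ)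
    (hX' : Integrable (fun ω => Real.exp (-(t * C) * X ω)) μ) :
    mgf Y μ t * mgf Y μ (-t) ≤ mgf X μ (t * C) * mgf X μ (-(t * C)) := by
  rw [← integral_cosh_mul_sub hY hY', ← integral_cosh_mul_sub hX hX']
  exact integral_mono (integrable_cosh_mul_sub hY hY') (integrable_cosh_mul_sub hX hX') fun p =>
    Real.cosh_le_cosh.2 (abs_mul_sub_le_of_abs_sub_le_mul hYX p.1 p.2)

end LipschitzImage

/-- Sub-gamma concentration: the centred exponential moments of `X` of order `t` are finite and at
most `exp (t² v)`, but only in the window `|t| r ≤ 1`. Unlike a sub-Gaussian bound, this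
lets `v` be of the order of the variance of `X` when `X` is rarely nonzero. -/
structure HasLocalMGFBound {Ω : Type*} [MeasurableSpace Ω] (X : Ω → ℝ) (r v : ℝ)
    (μ : Measure Ω) : Prop where
  integrable_exp_mul : ∀ t : ℝ, |t| * r ≤ 1 → Integrable (fun ω => Real.exp (t * X ω)) μ
  mgf_le : ∀ t : ℝ, |t| * r ≤ 1 → mgf X μ t ≤ Real.exp (t * μ[X] + t ^ 2 * v)

namespace HasLocalMGFBound

variable {Ω : Type*} [MeasurableSpace Ω] {μ : Measure Ω} {X : Ω → ℝ} {r v : ℝ}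

lemma integrable (h : HasLocalMGFBound X r v μ) : Integrable X μ :=
  integrable_of_integrable_exp_mul h.integrable_exp_mul

lemma const [IsProbabilityMeasure μ] (a r : ℝ) : HasLocalMGFBound (fun _ => a) r 0 μ where
  integrable_exp_mul _ _ := integrable_const _
  mgf_le t _ := by simp

lemma mono {v' : ℝ} (h : HasLocalMGFBound X r v μ) (hv : v ≤ v') :
    HasLocalMGFBound X r v' μ where
  integrable_exp_mul := h.integrable_exp_mul
  mgf_le t ht := (h.mgf_le t ht).trans (by gcongr)

lemma map {Ω' : Type*} [MeasurableSpace Ω'] {φ : Ω → Ω'} {X : Ω' → ℝ} (hφ : Measurable φ)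
    (hX : Measurable X) (h : HasLocalMGFBound (fun ω => X (φ ω)) r v μ) :
    HasLocalMGFBound X r v (μ.map φ) where
  integrable_exp_mul t ht :=
    (integrable_map_measure (by fun_prop) hφ.aemeasurable).2 (h.integrable_exp_mul t ht)
  mgf_le t ht := by
    rw [mgf_map hφ.aemeasurable (by fun_prop),
      integral_map hφ.aemeasurable hX.aestronglyMeasurable]
    exact h.mgf_le t ht

lemma of_integral_sq_le [IsProbabilityMeasure μ] (hX : Measurable X)
    (hosc : ∀ x y, |X x - X y| ≤ r) (a : ℝ) (hv : ∫ ω, (X ω - a) ^ 2 ∂μ ≤ v) :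
    HasLocalMGFBound X r v μ := by
  have hcentred : Measurable fun ω => X ω - μ[X] := hX.sub_const _
  have hdev := abs_sub_integral_le (μ := μ) hX hosc
  have hmean : ∫ ω, (X ω - μ[X]) ∂μ = 0 := by
    rw [integral_sub (integrable_of_abs_sub_le hX hosc) (integrable_const _)]
    simp
  have hshift (t ω) : Real.exp (t * X ω) = Real.exp (t * μ[X]) * Real.exp (t * (X ω - μ[X])) := by
    rw [← Real.exp_add]
    ring_nf
  have hvar : ∫ ω, (X ω - μ[X]) ^ 2 ∂μ ≤ v := by
    rw [← variance_eq_integral hX.aemeasurable, ← variance_sub_const hX.aestronglyMeasurable a]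
    exact (variance_le_expectation_sq (by fun_prop)).trans hv
  constructor <;> intro t ht
  · simp only [hshift]
    exact (integrable_exp_mul_of_mem_Icc hcentred.aemeasurable
      (ae_of_all μ fun ω => abs_le.1 (hdev ω))).const_mul _
  · calc mgf X μ t = Real.exp (t * μ[X]) * mgf (fun ω => X ω - μ[X]) μ t := by
          simp only [mgf, hshift, integral_const_mul]
      _ ≤ Real.exp (t * μ[X]) * Real.exp (t ^ 2 * v) := by
          gcongr
          exact (mgf_le_exp_of_abs_le hcentred hdev hmean ht).trans (by gcongr)
      _ = Real.exp (t * μ[X] + t ^ 2 * v) := (Real.exp_add _ _).symm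

lemma of_abs_sub_le [IsProbabilityMeasure μ] (hX : Measurable X)
    (hosc : ∀ x y, |X x - X y| ≤ r) : HasLocalMGFBound X r (r ^ 2) μ := by
  obtain ⟨x₀⟩ := μ.nonempty_of_neZero
  refine of_integral_sq_le hX hosc (X x₀) ?_
  calc ∫ x, (X x - X x₀) ^ 2 ∂μ ≤ ∫ _, r ^ 2 ∂μ :=
        integral_mono_of_nonneg (ae_of_all μ fun x => sq_nonneg _) (integrable_const _)
          (ae_of_all μ fun x => sq_le_sq' (abs_le.1 (hosc x x₀)).1 (abs_le.1 (hosc x x₀)).2)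
    _ = r ^ 2 := by simp

/-- The bounds `v₁` and `v₂` add up because `X - 𝔼 X` is the sum of the deviation of `X` from its
conditional mean and the deviation of this conditional mean from `𝔼 X`. -/
lemma compProd {Ω' : Type*} [MeasurableSpace Ω'] [SFinite μ] {κ : Kernel Ω Ω'}
    [IsSFiniteKernel κ] {X : Ω × Ω' → ℝ} {v₁ v₂ : ℝ} (hX : Measurable X)
    (h₁ : ∀ a, HasLocalMGFBound (fun b => X (a, b)) r v₁ (κ a))
    (h₂ : HasLocalMGFBound (fun a => ∫ b, X (a, b) ∂κ a) r v₂ μ) :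
    HasLocalMGFBound X r (v₁ + v₂) (μ ⊗ₘ κ) := by
  set g : Ω → ℝ := fun a => ∫ b, X (a, b) ∂κ a
  have hsection (t) (ht : |t| * r ≤ 1) (a) :
      ∫ b, Real.exp (t * X (a, b)) ∂κ a ≤ Real.exp (t ^ 2 * v₁) * Real.exp (t * g a) := by
    rw [← Real.exp_add, add_comm]
    exact (h₁ a).mgf_le t ht
  have hbound (t) (ht : |t| * r ≤ 1) :
      Integrable (fun a => Real.exp (t ^ 2 * v₁) * Real.exp (t * g a)) μ :=
    (h₂.integrable_exp_mul t ht).const_mul _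
  have hexp (t) (ht : |t| * r ≤ 1) : Integrable (fun p => Real.exp (t * X p)) (μ ⊗ₘ κ) := by
    have hmeas : StronglyMeasurable fun p => Real.exp (t * X p) :=
      (by fun_prop : Measurable fun p => Real.exp (t * X p)).stronglyMeasurable
    refine (Measure.integrable_compProd_iff hmeas.aestronglyMeasurable).2
      ⟨ae_of_all μ fun a => (h₁ a).integrable_exp_mul t ht, ?_⟩
    simp only [Real.norm_eq_abs, Real.abs_exp]
    refine (hbound t ht).mono' hmeas.integral_kernel_prod_right'.aestronglyMeasurable
      (ae_of_all μ fun a => ?_)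
    rw [Real.norm_eq_abs, abs_of_nonneg (integral_nonneg fun _ => Real.exp_nonneg _)]
    exact hsection t ht a
  refine ⟨hexp, fun t ht => ?_⟩
  calc mgf X (μ ⊗ₘ κ) t = ∫ a, ∫ b, Real.exp (t * X (a, b)) ∂κ a ∂μ :=
        Measure.integral_compProd (hexp t ht)
    _ ≤ ∫ a, Real.exp (t ^ 2 * v₁) * Real.exp (t * g a) ∂μ :=
      integral_mono_of_nonneg (ae_of_all μ fun _ => integral_nonneg fun _ => Real.exp_nonneg _)
        (hbound t ht) (ae_of_all μ (hsection t ht))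
    _ = Real.exp (t ^ 2 * v₁) * mgf g μ t := integral_const_mul _ _
    _ ≤ Real.exp (t ^ 2 * v₁) * Real.exp (t * μ[g] + t ^ 2 * v₂) := by
      gcongr
      exact h₂.mgf_le t ht
    _ = Real.exp (t * ∫ p, X p ∂(μ ⊗ₘ κ) + t ^ 2 * (v₁ + v₂)) := by
      rw [← Real.exp_add, Measure.integral_compProd (integrable_of_integrable_exp_mul hexp),
        add_left_comm, ← mul_add]

lemma prod {Ω' : Type*} [MeasurableSpace Ω'] {ν : Measure Ω'} [SFinite μ] [SFinite ν]
    {X : Ω × Ω' → ℝ} {v₁ v₂ : ℝ} (hX : Measurable X)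
    (h₁ : ∀ a, HasLocalMGFBound (fun b => X (a, b)) r v₁ ν)
    (h₂ : HasLocalMGFBound (fun a => ∫ b, X (a, b) ∂ν) r v₂ μ) :
    HasLocalMGFBound X r (v₁ + v₂) (μ.prod ν) := by
  rw [← Measure.compProd_const]
  exact compProd hX h₁ h₂

lemma bind {Ω' : Type*} [MeasurableSpace Ω'] [Countable Ω] [DiscreteMeasurableSpace Ω] [SFinite μ]
    {κ : Ω → Measure Ω'} [∀ a, IsProbabilityMeasure (κ a)] {X : Ω' → ℝ} {v₁ v₂ : ℝ}
    (hX : Measurable X) (h₁ : ∀ a, HasLocalMGFBound X r v₁ (κ a))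
    (h₂ : HasLocalMGFBound (fun a => (κ a)[X]) r v₂ μ) :
    HasLocalMGFBound X r (v₁ + v₂) (μ.bind κ) := by
  have : IsMarkovKernel (Kernel.ofFunOfCountable κ) :=
    ⟨fun a => inferInstanceAs (IsProbabilityMeasure (κ a))⟩
  have hbind : μ.bind κ = (μ ⊗ₘ Kernel.ofFunOfCountable κ).map Prod.snd :=
    (Measure.snd_compProd μ (Kernel.ofFunOfCountable κ)).symm
  rw [hbind]
  exact map measurable_snd hX (compProd (hX.comp measurable_snd) h₁ h₂)

lemma of_abs_sub_le_mul [IsProbabilityMeasure μ] {Y : Ω → ℝ} {C : ℝ} (hC : 0 ≤ C)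
    (hY : Measurable Y) (hX : HasLocalMGFBound X r v μ)
    (hYX : ∀ x y, |Y x - Y y| ≤ C * |X x - X y|) :
    HasLocalMGFBound Y (r * C) (2 * C ^ 2 * v) μ := by
  have hwindow {t : ℝ} (ht : |t| * (r * C) ≤ 1) : |t * C| * r ≤ 1 ∧ |-(t * C)| * r ≤ 1 := by
    rw [abs_neg, and_self, abs_mul, abs_of_nonneg hC]
    linarith
  have hintX (t) (ht : |t| * (r * C) ≤ 1) := hX.integrable_exp_mul _ (hwindow ht).1
  have hintX' (t) (ht : |t| * (r * C) ≤ 1) := hX.integrable_exp_mul _ (hwindow ht).2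
  have hintY (t : ℝ) (ht : |t| * (r * C) ≤ 1) : Integrable (fun ω => Real.exp (t * Y ω)) μ :=
    integrable_exp_mul_of_abs_sub_le_mul hY hYX (hintX t ht) (hintX' t ht)
  refine ⟨hintY, fun t ht => ?_⟩
  have hneg : |-t| * (r * C) ≤ 1 := by rwa [abs_neg]
  have hsymm := mgf_mul_mgf_neg_le_of_abs_sub_le_mul hYX (hintY t ht) (hintY (-t) hneg)
    (hintX t ht) (hintX' t ht)
  have hjensen : Real.exp (-t * μ[Y]) ≤ mgf Y μ (-t) :=
    exp_mul_integral_le_mgf (integrable_of_integrable_exp_mul hintY) (hintY (-t) hneg)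
  have hX₁ := hX.mgf_le _ (hwindow ht).1
  have hX₂ := hX.mgf_le _ (hwindow ht).2
  calc mgf Y μ t = mgf Y μ t * Real.exp (-t * μ[Y]) * Real.exp (t * μ[Y]) := by
        rw [mul_assoc, ← Real.exp_add]; simp
    _ ≤ mgf Y μ t * mgf Y μ (-t) * Real.exp (t * μ[Y]) := by
        gcongr
        exact mgf_nonneg
    _ ≤ mgf X μ (t * C) * mgf X μ (-(t * C)) * Real.exp (t * μ[Y]) := by gcongr
    _ ≤ Real.exp (t * C * μ[X] + (t * C) ^ 2 * v) *
          Real.exp (-(t * C) * μ[X] + (-(t * C)) ^ 2 * v) * Real.exp (t * μ[Y]) := by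
        gcongr
        exact mgf_nonneg
    _ = Real.exp (t * μ[Y] + t ^ 2 * (2 * C ^ 2 * v)) := by
        rw [← Real.exp_add, ← Real.exp_add]; ring_nf

lemma measureReal_lt_abs_le [IsProbabilityMeasure μ] (h : HasLocalMGFBound X r v μ) {t : ℝ}
    (ht0 : 0 ≤ t) (ht : t * r ≤ 1) (s : ℝ) :
    μ.real {ω | s < |X ω - μ[X]|} ≤ 2 * Real.exp (t ^ 2 * v - t * s) := by
  have hpos : |t| * r ≤ 1 := by rwa [abs_of_nonneg ht0]
  have hneg : |-t| * r ≤ 1 := by rwa [abs_neg]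
  have hupper := measure_ge_le_exp_mul_mgf (μ[X] + s) ht0 (h.integrable_exp_mul t hpos)
  have hlower := measure_le_le_exp_mul_mgf (μ[X] - s) (neg_nonpos.2 ht0)
    (h.integrable_exp_mul (-t) hneg)
  calc μ.real {ω | s < |X ω - μ[X]|}
      ≤ μ.real ({ω | μ[X] + s ≤ X ω} ∪ {ω | X ω ≤ μ[X] - s}) := by
        refine measureReal_mono fun ω (hω : s < |X ω - μ[X]|) => ?_
        rcases lt_abs.1 hω with hω | hω
        · exact .inl (by simp only [Set.mem_ofPred_eq]; linarith)
        · exact .inr (by simp only [Set.mem_ofPred_eq]; linarith)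
    _ ≤ μ.real {ω | μ[X] + s ≤ X ω} + μ.real {ω | X ω ≤ μ[X] - s} := measureReal_union_le _ _
    _ ≤ Real.exp (-t * (μ[X] + s)) * Real.exp (t * μ[X] + t ^ 2 * v) +
        Real.exp (-(-t) * (μ[X] - s)) * Real.exp (-t * μ[X] + (-t) ^ 2 * v) := by
      gcongr
      · exact hupper.trans (by gcongr; exact h.mgf_le t hpos)
      · exact hlower.trans (by gcongr; exact h.mgf_le (-t) hneg)
    _ = 2 * Real.exp (t ^ 2 * v - t * s) := by
      rw [← Real.exp_add, ← Real.exp_add]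
      ring_nf

end HasLocalMGFBound

lemma hasLocalMGFBound_pi_fin {N : ℕ} {α : Fin N → Type*} [∀ i, MeasurableSpace (α i)]
    (μ : ∀ i, Measure (α i)) [∀ i, IsProbabilityMeasure (μ i)] {r : ℝ} (v : Fin N → ℝ)
    (hv : ∀ i (g : α i → ℝ), Measurable g → (∀ a b, |g a - g b| ≤ r) →
      HasLocalMGFBound g r (v i) (μ i))
    {X : (∀ i, α i) → ℝ} (hX : Measurable X)
    (hosc : ∀ i x y, (∀ j ≠ i, x j = y j) → |X x - X y| ≤ r) :
    HasLocalMGFBound X r (∑ i, v i) (Measure.pi μ) := by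
  induction N with
  | zero =>
    have hconst : X = fun _ => X default := funext fun x => by rw [Subsingleton.elim x default]
    rw [hconst, Fin.sum_univ_zero]
    exact .const _ _
  | succ N ih =>
    let e := (MeasurableEquiv.piFinSuccAbove α 0).symm
    have he_zero (a y) : e (a, y) 0 = a := Fin.insertNth_apply_same 0 a y
    have he_succ (a y j) : e (a, y) (Fin.succAbove 0 j) = y j :=
      Fin.insertNth_apply_succAbove 0 a y j
    have hsection (a) : HasLocalMGFBound (fun y => X (e (a, y))) r
        (∑ j, v (Fin.succAbove 0 j)) (Measure.pi fun j => μ (Fin.succAbove 0 j)) := by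
      refine ih _ _ (fun j => hv _) (by fun_prop) fun i x y hxy =>
        hosc (Fin.succAbove 0 i) _ _ ((Fin.forall_iff_succAbove 0).2 ⟨fun _ => ?_, fun j hj => ?_⟩)
      · rw [he_zero, he_zero]
      · rw [he_succ, he_succ]
        exact hxy j (ne_of_apply_ne _ hj)
    have hmean : HasLocalMGFBound
        (fun a => ∫ y, X (e (a, y)) ∂Measure.pi fun j => μ (Fin.succAbove 0 j)) r (v 0) (μ 0) := by
      refine hv 0 _ ?_ fun a b => abs_integral_sub_integral_le (hsection a).integrable
        (hsection b).integrable fun y => hosc 0 _ _ ?_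
      · exact ((hX.comp e.measurable).stronglyMeasurable.integral_prod_right').measurable
      · refine (Fin.forall_iff_succAbove 0).2 ⟨fun h => (h rfl).elim, fun j _ => ?_⟩
        rw [he_succ, he_succ]
    have hlaw : Measure.pi μ = ((μ 0).prod (Measure.pi fun j => μ (Fin.succAbove 0 j))).map e :=
      (measurePreserving_piFinSuccAbove μ 0).symm.map_eq.symm
    rw [Fin.sum_univ_succAbove _ 0, add_comm (v 0), hlaw]
    exact (HasLocalMGFBound.prod (by fun_prop) hsection hmean).map e.measurable hX

/-- The method of bounded differences, with the oscillation bound `r` only controlling the window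
of admissible exponents. -/
lemma hasLocalMGFBound_pi {ι : Type*} [Fintype ι] {α : ι → Type*} [∀ i, MeasurableSpace (α i)]
    (μ : ∀ i, Measure (α i)) [∀ i, IsProbabilityMeasure (μ i)] {r : ℝ} (v : ι → ℝ)
    (hv : ∀ i (g : α i → ℝ), Measurable g → (∀ a b, |g a - g b| ≤ r) →
      HasLocalMGFBound g r (v i) (μ i))
    {X : (∀ i, α i) → ℝ} (hX : Measurable X)
    (hosc : ∀ i x y, (∀ j ≠ i, x j = y j) → |X x - X y| ≤ r) :
    HasLocalMGFBound X r (∑ i, v i) (Measure.pi μ) := by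
  let f := (Fintype.equivFin ι).symm
  let e := MeasurableEquiv.piCongrLeft α f
  rw [← (measurePreserving_piCongrLeft μ f).map_eq, ← f.sum_comp v]
  refine (hasLocalMGFBound_pi_fin _ _ (fun i => hv (f i)) (hX.comp e.measurable)
    fun i x y hxy => hosc (f i) _ _ (f.surjective.forall.2 fun j hj => ?_)).map e.measurable hX
  simpa only [e, MeasurableEquiv.piCongrLeft_apply_apply] using hxy j (ne_of_apply_ne f hj)

section UniformLaw

variable {α Ω : Type*} [MeasurableSpace Ω] {s : Finset α} {f : α → Ω}

lemma uniformLaw_apply {A : Set Ω} (hA : MeasurableSet A)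
    [DecidablePred fun a => f a ∈ A] :
    uniformLaw s f A = (s.card : ℝ≥0∞)⁻¹ * (s.filter fun a => f a ∈ A).card := by
  simp only [uniformLaw, Measure.smul_apply, Measure.coe_finsetSum, Finset.sum_apply, smul_eq_mul,
    Measure.dirac_apply' _ hA, Set.indicator_apply, Pi.one_apply, Finset.sum_boole]

lemma uniformLaw_congr {g : α → Ω} (h : ∀ a ∈ s, f a = g a) : uniformLaw s f = uniformLaw s g := by
  rw [uniformLaw, uniformLaw, Finset.sum_congr rfl fun a ha => by rw [h a ha]]

lemma isProbabilityMeasure_uniformLaw (f : α → Ω) (hs : s.Nonempty) :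
    IsProbabilityMeasure (uniformLaw s f) := by
  classical
  constructor
  simp only [uniformLaw_apply .univ, Set.mem_univ, Finset.filter_true]
  exact ENNReal.inv_mul_cancel (by simpa using hs.ne_empty) (by simp)

lemma map_uniformLaw {Ω' : Type*} [MeasurableSpace Ω'] {g : Ω → Ω'} (hg : Measurable g) :
    (uniformLaw s f).map g = uniformLaw s (fun a => g (f a)) := by
  classical
  ext A hA
  rw [Measure.map_apply hg hA, uniformLaw_apply (hg hA), uniformLaw_apply hA]
  rfl

lemma ae_uniformLaw {p : Ω → Prop} (hp : MeasurableSet {ω | p ω}) (h : ∀ a ∈ s, p (f a)) :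
    ∀ᵐ ω ∂uniformLaw s f, p ω := by
  classical
  have hempty : (s.filter fun a => f a ∈ {ω | p ω}ᶜ) = ∅ :=
    Finset.filter_false_of_mem fun a ha => not_not.2 (h a ha)
  change uniformLaw s f {ω | p ω}ᶜ = 0
  rw [uniformLaw_apply hp.compl, hempty]
  simp

lemma uniformLaw_comp_of_card_fiber_eq {β : Type*} [DecidableEq β] {t : Finset β} {g : α → β}
    (f : β → Ω) {c : ℕ} (hc : c ≠ 0) (hg : ∀ a ∈ s, g a ∈ t)
    (hfiber : ∀ b ∈ t, (s.filter fun a => g a = b).card = c) :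
    uniformLaw s (fun a => f (g a)) = uniformLaw t f := by
  classical
  have hcount (t' : Finset β) (ht' : t' ⊆ t) :
      (s.filter fun a => g a ∈ t').card = t'.card * c := by
    have hmaps : Set.MapsTo g (s.filter fun a => g a ∈ t') t' :=
      fun a ha => (Finset.mem_filter.1 ha).2
    rw [Finset.card_eq_sum_card_fiberwise hmaps, Finset.sum_const_nat fun b hb => ?_]
    rw [Finset.filter_filter, ← hfiber b (ht' hb)]
    congr 1
    exact Finset.filter_congr fun a _ => ⟨And.right, fun h => ⟨h ▸ hb, h⟩⟩
  have hs : s.card = t.card * c := by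
    rw [← hcount t subset_rfl, Finset.filter_true_of_mem hg]
  ext A hA
  rw [uniformLaw_apply hA, uniformLaw_apply hA, hs]
  have hA : (s.filter fun a => f (g a) ∈ A) =
      s.filter fun a => g a ∈ t.filter fun b => f b ∈ A :=
    Finset.filter_congr fun a ha => by simp [hg a ha]
  rw [hA, hcount _ (Finset.filter_subset _ _), Nat.cast_mul, Nat.cast_mul, mul_comm,
    mul_comm (t.card : ℝ≥0∞)⁻¹, ← div_eq_mul_inv, ← div_eq_mul_inv]
  exact ENNReal.mul_div_mul_right _ _ (by simpa using hc) (by simp)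

lemma uniformLaw_prod {β Ω' : Type*} [MeasurableSpace Ω'] {t : Finset β} {g : β → Ω'}
    (hs : s.Nonempty) (ht : t.Nonempty) :
    (uniformLaw s f).prod (uniformLaw t g) = uniformLaw (s ×ˢ t) (Prod.map f g) := by
  classical
  have := isProbabilityMeasure_uniformLaw f hs
  have := isProbabilityMeasure_uniformLaw g ht
  refine Measure.prod_eq fun A B hA hB => ?_
  have hfilter : ((s ×ˢ t).filter fun p => Prod.map f g p ∈ A ×ˢ B) =
      (s.filter fun a => f a ∈ A) ×ˢ (t.filter fun b => g b ∈ B) := by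
    rw [← Finset.filter_product]
    rfl
  rw [uniformLaw_apply (hA.prod hB), uniformLaw_apply hA, uniformLaw_apply hB, hfilter,
    Finset.card_product, Finset.card_product, Nat.cast_mul, Nat.cast_mul,
    ENNReal.mul_inv (by simp) (by simp), mul_mul_mul_comm]

lemma pi_uniformLaw {ι : Type*} [Fintype ι] [DecidableEq ι] {β Ω : ι → Type*}
    [∀ i, MeasurableSpace (Ω i)] {s : ∀ i, Finset (β i)} {f : ∀ i, β i → Ω i}
    (hs : ∀ i, (s i).Nonempty) :
    Measure.pi (fun i => uniformLaw (s i) (f i)) =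
      uniformLaw (Fintype.piFinset s) (fun a i => f i (a i)) := by
  classical
  have (i : ι) := isProbabilityMeasure_uniformLaw (f i) (hs i)
  refine Measure.pi_eq fun A hA => ?_
  have hfilter : ((Fintype.piFinset s).filter fun a => (fun i => f i (a i)) ∈ Set.univ.pi A) =
      Fintype.piFinset fun i => (s i).filter fun a => f i a ∈ A i := by
    ext a
    simp [Set.mem_pi, forall_and]
  rw [uniformLaw_apply (.univ_pi hA), hfilter, Fintype.card_piFinset, Fintype.card_piFinset]
  simp only [uniformLaw_apply (hA _), Finset.prod_mul_distrib, Nat.cast_prod]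
  rw [ENNReal.prod_inv_distrib fun i _ j _ _ => .inr (by simp)]

lemma uniformLaw_univ_equiv {β : Type*} [Fintype α] [Fintype β] (e : α ≃ β) (g : β → Ω) :
    uniformLaw Finset.univ (fun a => g (e a)) = uniformLaw Finset.univ g := by
  classical
  refine uniformLaw_comp_of_card_fiber_eq g one_ne_zero (fun _ _ => Finset.mem_univ _) fun b _ => ?_
  rw [Finset.card_eq_one]
  exact ⟨e.symm b, by ext a; simp [Equiv.eq_symm_apply]⟩

lemma measureReal_uniformLaw_le_of_subset {t : Finset α} (f : α → Ω)
    (hst : s ⊆ t) {L : ℝ} (hL : (t.card : ℝ) ≤ L * s.card) {A : Set Ω} (hA : MeasurableSet A) :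
    (uniformLaw s f).real A ≤ L * (uniformLaw t f).real A := by
  classical
  simp only [measureReal_def, uniformLaw_apply hA, ENNReal.toReal_mul, ENNReal.toReal_inv,
    ENNReal.toReal_natCast]
  obtain rfl | hs := s.eq_empty_or_nonempty
  · obtain rfl : t = ∅ := by simpa using hL
    simp
  have hs' : (0 : ℝ) < s.card := by exact_mod_cast hs.card_pos
  have ht' : (0 : ℝ) < t.card := by exact_mod_cast (hs.mono hst).card_pos
  have hcard : ((s.filter fun a => f a ∈ A).card : ℝ) ≤ (t.filter fun a => f a ∈ A).card := by
    exact_mod_cast Finset.card_le_card (Finset.filter_subset_filter _ hst)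
  rw [inv_mul_eq_div, inv_mul_eq_div, mul_div_assoc', div_le_div_iff₀ hs' ht']
  calc _ ≤ ((t.filter fun a => f a ∈ A).card : ℝ) * (L * s.card) := by gcongr
    _ = _ := by ring

end UniformLaw

section Permutations

open Equiv

instance (α : Type*) : MeasurableSpace (Perm α) := ⊤

instance (α : Type*) : DiscreteMeasurableSpace (Perm α) := ⟨fun _ => trivial⟩

lemma decomposeFin_symm_swap_mul {n : ℕ} (p : Fin (n + 1)) (a b : Fin n) (σ : Perm (Fin n)) :
    Perm.decomposeFin.symm (p, swap a b * σ) =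
      swap (swap 0 p a.succ) (swap 0 p b.succ) * Perm.decomposeFin.symm (p, σ) := by
  have hconj (y : Fin (n + 1)) : swap (swap 0 p a.succ) (swap 0 p b.succ) (swap 0 p y) =
      swap 0 p (swap a.succ b.succ y) :=
    (Perm.congr_fun (mul_swap_eq_swap_mul (swap 0 p) a.succ b.succ) y).symm
  ext x
  refine congrArg Fin.val (Fin.cases ?_ (fun i => ?_) x)
  · have hzero : swap a.succ b.succ 0 = 0 :=
      swap_apply_of_ne_of_ne (Fin.succ_ne_zero a).symm (Fin.succ_ne_zero b).symm
    simpa [hzero] using (hconj 0).symm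
  · rw [Perm.mul_apply, Perm.decomposeFin_symm_apply_succ, Perm.decomposeFin_symm_apply_succ,
      hconj, Perm.mul_apply, (Fin.succ_injective n).map_swap]

lemma decomposeFin_symm_eq_swap_mul {n : ℕ} (p : Fin (n + 1)) (σ : Perm (Fin n)) :
    Perm.decomposeFin.symm (p, σ) = swap 0 p * Perm.decomposeFin.symm (0, σ) := by
  ext x
  refine congrArg Fin.val (Fin.cases ?_ (fun i => ?_) x) <;> simp

variable {c : ℝ}

lemma hasLocalMGFBound_perm_fin {n : ℕ} {X : Perm (Fin n) → ℝ}
    (hX : ∀ (σ : Perm (Fin n)) (a b : Fin n), |X (swap a b * σ) - X σ| ≤ c) :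
    HasLocalMGFBound X (2 * c) (n * (2 * c) ^ 2) (uniformLaw Finset.univ id) := by
  have hprob (m : ℕ) : IsProbabilityMeasure (uniformLaw (Ω := Perm (Fin m)) Finset.univ id) :=
    isProbabilityMeasure_uniformLaw id Finset.univ_nonempty
  induction n with
  | zero =>
    have hconst : X = fun _ => X 1 := funext fun σ => by rw [Subsingleton.elim σ 1]
    rw [hconst, Nat.cast_zero, zero_mul]
    exact .const _ _
  | succ n ih =>
    let e := (Perm.decomposeFin (n := n)).symm
    have := isProbabilityMeasure_uniformLaw (id : Fin (n + 1) → _) Finset.univ_nonempty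
    have hlaw : uniformLaw Finset.univ id = ((uniformLaw Finset.univ id).prod
        (uniformLaw Finset.univ id)).map e := by
      rw [uniformLaw_prod Finset.univ_nonempty Finset.univ_nonempty, map_uniformLaw .of_discrete,
        Finset.univ_product_univ]
      exact (uniformLaw_univ_equiv e id).symm
    have hsection (p) : HasLocalMGFBound (fun σ => X (e (p, σ))) (2 * c) (n * (2 * c) ^ 2)
        (uniformLaw Finset.univ id) :=
      ih fun σ a b => by
        rw [decomposeFin_symm_swap_mul]
        exact hX _ _ _
    have hmean : HasLocalMGFBound (fun p => ∫ σ, X (e (p, σ)) ∂uniformLaw Finset.univ id) (2 * c)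
        ((2 * c) ^ 2) (uniformLaw Finset.univ id) := by
      refine .of_abs_sub_le .of_discrete fun p p' => abs_integral_sub_integral_le
        (hsection p).integrable (hsection p').integrable fun σ => ?_
      have h := hX (e (0, σ)) 0
      rw [decomposeFin_symm_eq_swap_mul p, decomposeFin_symm_eq_swap_mul p']
      rw [two_mul]
      exact (abs_sub_le _ (X (e (0, σ))) _).trans
        (add_le_add (h p) ((abs_sub_comm _ _).trans_le (h p')))
    rw [hlaw, Nat.cast_succ, add_mul, one_mul]
    exact (HasLocalMGFBound.prod .of_discrete hsection hmean).map .of_discrete .of_discrete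

lemma hasLocalMGFBound_perm {α : Type*} [Fintype α] [DecidableEq α] {X : Perm α → ℝ}
    (hX : ∀ (σ : Perm α) (a b : α), |X (swap a b * σ) - X σ| ≤ c) :
    HasLocalMGFBound X (2 * c) (Fintype.card α * (2 * c) ^ 2) (uniformLaw Finset.univ id) := by
  let e := (Fintype.equivFin α).symm
  have hlaw : (uniformLaw Finset.univ id).map e.permCongr = uniformLaw Finset.univ id := by
    rw [map_uniformLaw .of_discrete]
    exact uniformLaw_univ_equiv e.permCongr id
  rw [← hlaw]
  refine (hasLocalMGFBound_perm_fin fun σ a b => ?_).map .of_discrete .of_discrete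
  have hswap : e.permCongr (swap a b * σ) = swap (e a) (e b) * e.permCongr σ := by
    ext x
    exact e.injective.map_swap _ _ _
  rw [hswap]
  exact hX _ _ _

end Permutations

section ExponentialDecay

/-- The sequence `p` decays at least exponentially along the filter `l`. Restrictions such as `n`
even are encoded in `l`. -/
def ExponentiallySmall (l : Filter ℕ) (p : ℕ → ℝ) : Prop :=
  ∃ c : ℝ, 0 < c ∧ ∀ᶠ n in l, p n ≤ Real.exp (-c * n)

namespace ExponentiallySmall

variable {l : Filter ℕ} {p p' : ℕ → ℝ}

lemma mono (h : ExponentiallySmall l p) (hle : ∀ᶠ n in l, p' n ≤ p n) :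
    ExponentiallySmall l p' := by
  obtain ⟨c, hc, h⟩ := h
  exact ⟨c, hc, by filter_upwards [h, hle] with n hn hle using hle.trans hn⟩

lemma const_mul_pow_mul (h : ExponentiallySmall l p) (hl : l ≤ atTop) {K : ℝ} (hK : 0 ≤ K)
    (k : ℕ) : ExponentiallySmall l fun n => K * (n : ℝ) ^ k * p n := by
  obtain ⟨c, hc, h⟩ := h
  have hlim : Tendsto (fun n : ℕ => K * (n : ℝ) ^ k * Real.exp (-(c / 2) * n)) atTop (nhds 0) := by
    have := (tendsto_pow_const_mul_const_pow_of_lt_one k (Real.exp_nonneg (-(c / 2)))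
      (Real.exp_lt_one_iff.mpr (by linarith))).const_mul K
    simpa only [mul_zero, ← mul_assoc, ← Real.exp_nat_mul, mul_comm (_ : ℝ) (-(c / 2))] using this
  refine ⟨c / 2, half_pos hc, ?_⟩
  filter_upwards [h, hl (hlim.eventually_le_const one_pos)] with n hn hle
  calc K * (n : ℝ) ^ k * p n ≤ K * (n : ℝ) ^ k * Real.exp (-c * n) := by gcongr
    _ = K * (n : ℝ) ^ k * Real.exp (-(c / 2) * n) * Real.exp (-(c / 2) * n) := by
      rw [mul_assoc _ (Real.exp _), ← Real.exp_add]; ring_nf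
    _ ≤ 1 * Real.exp (-(c / 2) * n) := by gcongr
    _ = _ := one_mul _

lemma const_mul (h : ExponentiallySmall l p) (hl : l ≤ atTop) {K : ℝ} (hK : 0 ≤ K) :
    ExponentiallySmall l fun n => K * p n := by
  simpa using h.const_mul_pow_mul hl hK 0

lemma eventually_le (h : ExponentiallySmall l p) (hl : l ≤ atTop) {s : ℝ} (hs : 0 < s) :
    ∀ᶠ n in l, p n ≤ s := by
  obtain ⟨c, hc, h⟩ := h.const_mul hl (inv_nonneg.2 hs.le)
  filter_upwards [h] with n hn
  have : Real.exp (-c * n) ≤ 1 := Real.exp_le_one_iff.2 (by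
    rw [neg_mul, neg_nonpos]; positivity)
  simpa [inv_mul_le_iff₀ hs] using hn.trans this

lemma exists_common_rate {l' : Filter ℕ} (h : ExponentiallySmall l p)
    (h' : ExponentiallySmall l' p') :
    ∃ c : ℝ, 0 < c ∧ (∀ᶠ n in l, p n ≤ Real.exp (-c * n)) ∧
      ∀ᶠ n in l', p' n ≤ Real.exp (-c * n) := by
  obtain ⟨c, hc, h⟩ := h
  obtain ⟨c', hc', h'⟩ := h'
  refine ⟨min c c', lt_min hc hc', h.mono fun n hn => hn.trans ?_, h'.mono fun n hn => hn.trans ?_⟩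
  · gcongr; exact min_le_left c c'
  · gcongr; exact min_le_right c c'

end ExponentiallySmall

lemma deviationProb_map {Ω Ω' : Type*} [MeasurableSpace Ω] [MeasurableSpace Ω'] {μ : Measure Ω}
    {f : Ω → Ω'} (hf : Measurable f) {X : Ω' → ℝ} (hX : Measurable X) (t : ℝ) :
    deviationProb (μ.map f) X t = deviationProb μ (fun ω => X (f ω)) t := by
  rw [deviationProb, deviationProb, integral_map hf.aemeasurable hX.aestronglyMeasurable,
    map_measureReal_apply hf (measurableSet_lt measurable_const (hX.sub_const _).abs)]
  rfl

lemma exists_chernoff_parameter {r v s : ℝ} (hr : 0 ≤ r) (hv : 0 ≤ v) (hs : 0 < s) :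
    ∃ t : ℝ, 0 < t ∧ t * r ≤ 1 ∧ t ^ 2 * v - t * s ≤ -(t * s / 2) := by
  refine ⟨min (1 / (r + 1)) (s / (2 * (v + 1))), by positivity, ?_, ?_⟩
  · calc min (1 / (r + 1)) (s / (2 * (v + 1))) * r ≤ 1 / (r + 1) * r := by
          gcongr; exact min_le_left _ _
      _ ≤ 1 := by rw [div_mul_eq_mul_div, div_le_one (by positivity)]; linarith
  · set t := min (1 / (r + 1)) (s / (2 * (v + 1)))
    have ht0 : 0 < t := by positivity
    have h : t * v ≤ s / 2 := by
      calc t * v ≤ s / (2 * (v + 1)) * v := by gcongr; exact min_le_right _ _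
        _ ≤ s / 2 := by
          rw [div_mul_eq_mul_div, div_le_div_iff₀ (by positivity) (by positivity)]
          nlinarith
    nlinarith

variable {l : Filter ℕ} {Ω : ℕ → Type*} [∀ n, MeasurableSpace (Ω n)] {μ ν : ∀ n, Measure (Ω n)}
  {X : ∀ n, Ω n → ℝ}

lemma exponentiallySmall_deviationProb_of_hasLocalMGFBound (hl : l ≤ atTop) {r v : ℝ}
    (hr : 0 ≤ r) (hv : 0 ≤ v)
    (h : ∀ᶠ n in l, IsProbabilityMeasure (μ n) ∧ HasLocalMGFBound (X n) r (v * n) (μ n))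
    {δ : ℝ} (hδ : 0 < δ) :
    ExponentiallySmall l fun n => deviationProb (μ n) (X n) (δ * n) := by
  obtain ⟨t, ht, htr, hexp⟩ := exists_chernoff_parameter hr hv hδ
  have hsmall : ExponentiallySmall l fun n => Real.exp (-(t * δ / 2) * n) :=
    ⟨t * δ / 2, by positivity, .of_forall fun _ => le_rfl⟩
  refine (hsmall.const_mul hl zero_le_two).mono ?_
  filter_upwards [h] with n ⟨_, hn⟩
  calc deviationProb (μ n) (X n) (δ * n) ≤ 2 * Real.exp (t ^ 2 * (v * n) - t * (δ * n)) :=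
        hn.measureReal_lt_abs_le ht.le htr (δ * n)
    _ ≤ 2 * Real.exp (-(t * δ / 2) * n) := by
        gcongr
        linarith [mul_le_mul_of_nonneg_right hexp (Nat.cast_nonneg (α := ℝ) n)]

lemma abs_integral_sub_le_of_ae_le {Ω : Type*} [MeasurableSpace Ω] {μ : Measure Ω}
    [IsProbabilityMeasure μ] {X : Ω → ℝ} (hX : Measurable X) {a s R : ℝ} (hs : 0 ≤ s)
    (hb : ∀ᵐ ω ∂μ, |X ω - a| ≤ R) :
    |μ[X] - a| ≤ s + R * μ.real {ω | s < |X ω - a|} := by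
  have hS : MeasurableSet {ω | s < |X ω - a|} :=
    measurableSet_lt measurable_const (hX.sub_const _).abs
  have hint : Integrable (fun ω => X ω - a) μ :=
    .of_bound (hX.sub_const _).aestronglyMeasurable R hb
  have hXint : Integrable X μ := (integrable_add_const_iff (c := -a)).1 hint
  have hind : Integrable ({ω | s < |X ω - a|}.indicator fun _ => R) μ :=
    (integrable_const R).indicator hS
  calc |μ[X] - a| = |∫ ω, (X ω - a) ∂μ| := by
        rw [integral_sub hXint (integrable_const _)]; simp
    _ ≤ ∫ ω, |X ω - a| ∂μ := abs_integral_le_integral_abs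
    _ ≤ ∫ ω, (s + {ω | s < |X ω - a|}.indicator (fun _ => R) ω) ∂μ := by
        refine integral_mono_ae hint.abs ((integrable_const _).add hind) ?_
        filter_upwards [hb] with ω hω
        by_cases h : s < |X ω - a|
        · rw [Set.indicator_of_mem (by exact h)]
          linarith
        · rw [Set.indicator_of_notMem (by exact h)]
          linarith
    _ = s + R * μ.real {ω | s < |X ω - a|} := by
        rw [integral_add (integrable_const _) hind, integral_indicator_const _ hS]
        simp [mul_comm]

lemma exponentiallySmall_deviationProb_of_forall_measureReal (hl : l ≤ atTop)
    (hX : ∀ n, Measurable (X n)) {a : ℕ → ℝ} {C : ℝ} (hC : 0 ≤ C)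
    (hμ : ∀ᶠ n in l, IsProbabilityMeasure (μ n) ∧ ∀ᵐ ω ∂μ n, |X n ω - a n| ≤ C * n)
    (h : ∀ s : ℝ, 0 < s →
      ExponentiallySmall l fun n => (μ n).real {ω | s * n < |X n ω - a n|})
    {δ : ℝ} (hδ : 0 < δ) :
    ExponentiallySmall l fun n => deviationProb (μ n) (X n) (δ * n) := by
  have hsmall := h (δ / 4) (by positivity)
  refine hsmall.mono ?_
  filter_upwards [hμ, (hsmall.const_mul hl hC).eventually_le hl (by positivity : 0 < δ / 4)]
    with n ⟨_, hb⟩ htail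
  have hn : (0 : ℝ) ≤ n := Nat.cast_nonneg n
  have hmean : |(μ n)[X n] - a n| ≤ δ / 2 * n := by
    refine (abs_integral_sub_le_of_ae_le (hX n) (by positivity : 0 ≤ δ / 4 * n) hb).trans ?_
    linarith [mul_le_mul_of_nonneg_right htail hn]
  refine measureReal_mono fun ω hω => ?_
  simp only [Set.mem_ofPred_eq, gt_iff_lt] at hω ⊢
  have := abs_sub_abs_le_abs_sub (X n ω - a n) (X n ω - (μ n)[X n])
  have := abs_sub_le (X n ω) (a n) ((μ n)[X n])
  rw [abs_sub_comm (a n)] at this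
  linarith [mul_nonneg hδ.le hn]

/-- The mean under `ν` still serves as a centre under `μ`, up to an error of order `o(n)`. -/
lemma exponentiallySmall_deviationProb_of_measureReal_le (hl : l ≤ atTop)
    (hX : ∀ n, Measurable (X n)) {a : ℕ → ℝ} {C K : ℝ} (hC : 0 ≤ C) (hK : 0 ≤ K) {k : ℕ}
    (hμ : ∀ᶠ n in l, IsProbabilityMeasure (μ n))
    (hν : ∀ᶠ n in l, IsProbabilityMeasure (ν n) ∧ ∀ᵐ ω ∂ν n, |X n ω - a n| ≤ C * n)
    (hle : ∀ᶠ n in l, ∀ s, MeasurableSet s → (μ n).real s ≤ K * (n : ℝ) ^ k * (ν n).real s)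
    (h : ∀ s : ℝ, 0 < s → ExponentiallySmall l fun n => deviationProb (ν n) (X n) (s * n))
    {δ : ℝ} (hδ : 0 < δ) :
    ExponentiallySmall l fun n => deviationProb (μ n) (X n) (δ * n) := by
  refine exponentiallySmall_deviationProb_of_forall_measureReal hl hX
    (a := fun n => (ν n)[X n]) (mul_nonneg zero_le_two hC) ?_ (fun s hs => ?_) hδ
  · filter_upwards [hμ, hν, hle] with n hμn ⟨_, hb⟩ hle
    refine ⟨hμn, ?_⟩
    have hmean : |(ν n)[X n] - a n| ≤ C * n := by
      have hnull : (ν n).real {ω | C * n < |X n ω - a n|} = 0 := by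
        simpa [measureReal_def, ae_iff] using congrArg ENNReal.toReal (ae_iff.1 hb)
      have := abs_integral_sub_le_of_ae_le (hX n) (by positivity : 0 ≤ C * n) hb
      rwa [hnull, mul_zero, add_zero] at this
    have hac : μ n ≪ ν n := .mk fun s hs hνs => by
      have hμs : (μ n).real s ≤ 0 := by simpa [measureReal_def, hνs] using hle s hs
      exact (measureReal_eq_zero_iff).1 (hμs.antisymm measureReal_nonneg)
    filter_upwards [hac.ae_le hb] with ω hω
    have := abs_sub_le (X n ω) (a n) ((ν n)[X n])
    rw [abs_sub_comm (a n)] at this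
    linarith
  · refine ((h s hs).const_mul_pow_mul hl hK k).mono ?_
    filter_upwards [hle] with n hle
    exact hle _ (measurableSet_lt measurable_const ((hX n).sub_const _).abs)

end ExponentialDecay

section PartitionFunction

variable {V : Type*} {q : ℕ} {β : ℝ}

lemma exp_neg_le_edgeWeight (hβ : 0 ≤ β) (σ : V → Fin q) (e : Sym2 V) :
    Real.exp (-β) ≤ edgeWeight β σ e := by
  have : Real.exp (-β) ≤ 1 := Real.exp_le_one_iff.2 (by linarith)
  unfold edgeWeight
  split_ifs <;> linarith

lemma edgeWeight_le_one (hβ : 0 ≤ β) (σ : V → Fin q) (e : Sym2 V) : edgeWeight β σ e ≤ 1 := by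
  have : Real.exp (-β) ≤ 1 := Real.exp_le_one_iff.2 (by linarith)
  unfold edgeWeight
  split_ifs <;> linarith

lemma prod_edgeWeight_pos (hβ : 0 ≤ β) (σ : V → Fin q) (S : Multiset (Sym2 V)) :
    0 < (S.map (edgeWeight β σ)).prod := by
  refine Multiset.prod_induction (fun x => 0 < x) _ (fun _ _ => mul_pos) one_pos fun x hx => ?_
  obtain ⟨e, _, rfl⟩ := Multiset.mem_map.1 hx
  exact (Real.exp_pos _).trans_le (exp_neg_le_edgeWeight hβ σ e)

lemma prod_edgeWeight_le_one (hβ : 0 ≤ β) (σ : V → Fin q) (S : Multiset (Sym2 V)) :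
    (S.map (edgeWeight β σ)).prod ≤ 1 := by
  induction S using Multiset.induction_on with
  | empty => simp
  | cons e S ih =>
    rw [Multiset.map_cons, Multiset.prod_cons]
    exact mul_le_one₀ (edgeWeight_le_one hβ σ e) (prod_edgeWeight_pos hβ σ S).le ih

lemma exp_neg_pow_le_prod_edgeWeight (hβ : 0 ≤ β) (σ : V → Fin q) (S : Multiset (Sym2 V)) :
    Real.exp (-β) ^ S.card ≤ (S.map (edgeWeight β σ)).prod := by
  induction S using Multiset.induction_on with
  | empty => simp
  | cons e S ih =>
    rw [Multiset.map_cons, Multiset.prod_cons, Multiset.card_cons, pow_succ']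
    exact mul_le_mul (exp_neg_le_edgeWeight hβ σ e) ih (by positivity)
      ((Real.exp_pos _).trans_le (exp_neg_le_edgeWeight hβ σ e)).le

variable [Fintype V]

lemma partitionFunction_pos (hq : 1 ≤ q) (hβ : 0 ≤ β) (G : Multigraph V) :
    0 < G.partitionFunction q β := by
  have : Nonempty (Fin q) := ⟨⟨0, hq⟩⟩
  unfold Multigraph.partitionFunction
  classical
  exact Finset.sum_pos (fun σ _ => prod_edgeWeight_pos hβ σ _)
    ⟨Classical.arbitrary _, Finset.mem_univ _⟩

lemma logZ_add_le (hq : 1 ≤ q) (hβ : 0 ≤ β) (S A : Multiset (Sym2 V)) :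
    (⟨S + A⟩ : Multigraph V).logZ q β ≤ (⟨S⟩ : Multigraph V).logZ q β := by
  refine Real.log_le_log (partitionFunction_pos hq hβ _) (Finset.sum_le_sum fun σ _ => ?_)
  rw [Multiset.map_add, Multiset.prod_add]
  exact mul_le_of_le_one_right (prod_edgeWeight_pos hβ σ S).le (prod_edgeWeight_le_one hβ σ A)

lemma logZ_sub_le_logZ_add (hq : 1 ≤ q) (hβ : 0 ≤ β) (S A : Multiset (Sym2 V)) :
    (⟨S⟩ : Multigraph V).logZ q β - β * A.card ≤ (⟨S + A⟩ : Multigraph V).logZ q β := by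
  have h : Real.exp (-β) ^ A.card * (⟨S⟩ : Multigraph V).partitionFunction q β ≤
      (⟨S + A⟩ : Multigraph V).partitionFunction q β := by
    unfold Multigraph.partitionFunction
    rw [Finset.mul_sum]
    refine Finset.sum_le_sum fun σ _ => ?_
    rw [Multiset.map_add, Multiset.prod_add, mul_comm]
    exact mul_le_mul_of_nonneg_left (exp_neg_pow_le_prod_edgeWeight hβ σ A)
      (prod_edgeWeight_pos hβ σ S).le
  have hS := partitionFunction_pos hq hβ (⟨S⟩ : Multigraph V)
  have := Real.log_le_log (by positivity) h
  rw [Real.log_mul (by positivity) hS.ne', Real.log_pow, Real.log_exp] at this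
  unfold Multigraph.logZ
  linarith

lemma abs_logZ_add_sub_logZ_add_le (hq : 1 ≤ q) (hβ : 0 ≤ β) (S A B : Multiset (Sym2 V)) {k : ℕ}
    (hA : A.card ≤ k) (hB : B.card ≤ k) :
    |(⟨S + A⟩ : Multigraph V).logZ q β - (⟨S + B⟩ : Multigraph V).logZ q β| ≤ β * k := by
  have h1 := logZ_add_le hq hβ S A
  have h2 := logZ_sub_le_logZ_add hq hβ S A
  have h3 := logZ_add_le hq hβ S B
  have h4 := logZ_sub_le_logZ_add hq hβ S B
  have h5 : β * A.card ≤ β * k := by gcongr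
  have h6 : β * B.card ≤ β * k := by gcongr
  rw [abs_le]
  constructor <;> linarith

lemma abs_logZ_sub_logZ_empty_le (hq : 1 ≤ q) (hβ : 0 ≤ β) (G : Multigraph V) :
    |G.logZ q β - (⟨0⟩ : Multigraph V).logZ q β| ≤ β * G.edges.card := by
  simpa using abs_logZ_add_sub_logZ_add_le hq hβ 0 G.edges 0 le_rfl (by simp)

/-- The multigraph with a given family of edges. -/
def Multigraph.ofEdges {V ι : Type*} [Fintype ι] (e : ι → Sym2 V) : Multigraph V :=
  ⟨Finset.univ.val.map e⟩

lemma abs_logZ_ofEdges_sub_logZ_ofEdges_le (hq : 1 ≤ q) (hβ : 0 ≤ β) {ι : Type*} [Fintype ι]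
    {e e' : ι → Sym2 V} (T : Finset ι) (h : ∀ i ∉ T, e i = e' i) :
    |(Multigraph.ofEdges e).logZ q β - (Multigraph.ofEdges e').logZ q β| ≤ β * T.card := by
  classical
  have hsplit (f : ι → Sym2 V) : Multigraph.ofEdges f = ⟨Tᶜ.val.map f + T.val.map f⟩ := by
    rw [Multigraph.ofEdges, ← Multiset.map_add, ← Finset.disjUnion_val _ _ disjoint_compl_left,
      Finset.disjUnion_eq_union, Finset.union_comm, Finset.union_compl]
  have hcompl : Tᶜ.val.map e = Tᶜ.val.map e' :=
    Multiset.map_congr rfl fun i hi => h i (Finset.mem_compl.1 hi)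
  rw [hsplit, hsplit, hcompl]
  exact abs_logZ_add_sub_logZ_add_le hq hβ _ _ _ (by simp) (by simp)

lemma abs_logZ_ofEdges_sub_logZ_ofEdges_tail_le (hq : 1 ≤ q) (hβ : 0 ≤ β) {m : ℕ}
    (e : Fin (m + 1) → Sym2 V) :
    |(Multigraph.ofEdges e).logZ q β - (Multigraph.ofEdges (Fin.tail e)).logZ q β| ≤ β := by
  have hedges : Multigraph.ofEdges e = ⟨(Multigraph.ofEdges (Fin.tail e)).edges + {e 0}⟩ := by
    simp [Multigraph.ofEdges, Fin.univ_succ, add_comm, Function.comp_def, Fin.tail_def]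
  rw [hedges]
  simpa using abs_logZ_add_sub_logZ_add_le hq hβ (Multigraph.ofEdges (Fin.tail e)).edges {e 0} 0
    le_rfl (by simp)

end PartitionFunction

section PoissonMixture

lemma hasSum_exp_mul_poisson (r : NNReal) (t : ℝ) :
    HasSum (fun n : ℕ => Real.exp (-r) * r ^ n / n.factorial * Real.exp (t * n))
      (Real.exp (r * (Real.exp t - 1))) := by
  have h := (NormedSpace.expSeries_div_hasSum_exp (r * Real.exp t : ℝ)).mul_left (Real.exp (-r))
  rw [← Real.exp_eq_exp_ℝ, ← Real.exp_add] at h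
  rw [show (r : ℝ) * (Real.exp t - 1) = -r + r * Real.exp t by ring]
  refine h.congr_fun fun n => ?_
  rw [mul_pow, ← Real.exp_nat_mul, mul_comm t]
  ring

lemma integrable_exp_mul_poissonMeasure (r : NNReal) (t : ℝ) :
    Integrable (fun n : ℕ => Real.exp (t * n)) (poissonMeasure r) := by
  rw [integrable_poissonMeasure_iff]
  simpa using (hasSum_exp_mul_poisson r t).summable

lemma mgf_poissonMeasure (r : NNReal) (t : ℝ) :
    mgf (fun n : ℕ => (n : ℝ)) (poissonMeasure r) t = Real.exp (r * (Real.exp t - 1)) := by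
  rw [mgf, integral_poissonMeasure, ← (hasSum_exp_mul_poisson r t).tsum_eq]
  simp

lemma integral_natCast_poissonMeasure (r : NNReal) : ∫ n : ℕ, (n : ℝ) ∂poissonMeasure r = r := by
  have hset : integrableExpSet (fun n : ℕ => (n : ℝ)) (poissonMeasure r) = Set.univ :=
    Set.eq_univ_of_forall (integrable_exp_mul_poissonMeasure r)
  have hderiv : HasDerivAt (mgf (fun n : ℕ => (n : ℝ)) (poissonMeasure r)) r 0 := by
    rw [funext (mgf_poissonMeasure r)]
    simpa using (((Real.hasDerivAt_exp 0).sub_const 1).const_mul (r : ℝ)).exp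
  rw [← hderiv.deriv, deriv_mgf_zero (by simp [hset])]

lemma hasLocalMGFBound_poissonMeasure (r : NNReal) :
    HasLocalMGFBound (fun n : ℕ => (n : ℝ)) 1 r (poissonMeasure r) where
  integrable_exp_mul t _ := integrable_exp_mul_poissonMeasure r t
  mgf_le t ht := by
    have hexp := (abs_le.1 (Real.abs_exp_sub_one_sub_id_le (by simpa using ht))).2
    rw [mgf_poissonMeasure, integral_natCast_poissonMeasure, Real.exp_le_exp]
    nlinarith [r.coe_nonneg]

variable {ε d : ℝ}

lemma toNNReal_edgeNumber_mean (hε1 : ε ≤ 1) (hd : 0 < d) (n : ℕ) :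
    (((1 - ε) * d * n / 2).toNNReal : ℝ) = (1 - ε) * d / 2 * n := by
  have : 0 ≤ 1 - ε := by linarith
  rw [Real.coe_toNNReal _ (by positivity)]
  ring

lemma eventually_half_le_poissonMeasure (hε : 0 < ε) (hε1 : ε ≤ 1) (hd : 0 < d) :
    ∀ᶠ n : ℕ in atTop, 1 / 2 ≤ (poissonMeasure ((1 - ε) * d * n / 2).toNNReal).real
      {m : ℕ | (m : ℝ) ≤ d * n / 2} := by
  have : 0 ≤ 1 - ε := by linarith
  have hmean := toNNReal_edgeNumber_mean hε1 hd
  have hdev := exponentiallySmall_deviationProb_of_hasLocalMGFBound (l := atTop) le_rfl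
    zero_le_one (by positivity : 0 ≤ (1 - ε) * d / 2) (.of_forall fun n => ⟨inferInstance,
      hmean n ▸ hasLocalMGFBound_poissonMeasure ((1 - ε) * d * n / 2).toNNReal⟩)
    (by positivity : 0 < ε * d / 2)
  filter_upwards [hdev.eventually_le le_rfl (half_pos one_pos)] with n hn
  set μ := poissonMeasure ((1 - ε) * d * n / 2).toNNReal
  have hcompl : μ.real {m : ℕ | (m : ℝ) ≤ d * n / 2}ᶜ ≤ 1 / 2 := by
    refine (measureReal_mono fun m hm => ?_).trans hn
    simp only [Set.mem_compl_iff, Set.mem_ofPred_eq, not_le, μ, integral_natCast_poissonMeasure,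
      hmean] at hm ⊢
    exact lt_of_lt_of_le (by linarith) (le_abs_self _)
  rw [probReal_compl_eq_one_sub .of_discrete] at hcompl
  linarith

lemma measureReal_bind_edgeNumber_le {n : ℕ} {Ω : Type*} [MeasurableSpace Ω]
    {κ κ' : ℕ → Measure Ω} (hκ : ∀ m : ℕ, (m : ℝ) ≤ d * n / 2 → κ m = κ' m)
    [∀ m, IsProbabilityMeasure (κ' m)]
    (hhalf : 1 / 2 ≤ (poissonMeasure ((1 - ε) * d * n / 2).toNNReal).real
      {m : ℕ | (m : ℝ) ≤ d * n / 2}) {s : Set Ω} (hs : MeasurableSet s) :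
    ((edgeNumber ε d n).bind κ).real s ≤
      2 * ((poissonMeasure ((1 - ε) * d * n / 2).toNNReal).bind κ').real s := by
  set μ := poissonMeasure ((1 - ε) * d * n / 2).toNNReal with hμ
  set A := {m : ℕ | (m : ℝ) ≤ d * n / 2} with hA
  have hbind : IsProbabilityMeasure (μ.bind κ') :=
    isProbabilityMeasure_bind .of_discrete (ae_of_all μ inferInstance)
  have hle : (edgeNumber ε d n).bind κ s ≤ 2 * (μ.bind κ') s := by
    rw [Measure.bind_apply hs .of_discrete, Measure.bind_apply hs .of_discrete, edgeNumber,
      ← hμ, ← hA, ProbabilityTheory.cond, lintegral_smul_measure, smul_eq_mul]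
    have hinv : (μ A)⁻¹ ≤ 2 := by
      rw [ENNReal.inv_le_iff_inv_le, ← ENNReal.ofReal_toReal (measure_ne_top μ A),
        ← ENNReal.ofReal_ofNat, ← ENNReal.ofReal_inv_of_pos two_pos]
      exact ENNReal.ofReal_le_ofReal (by simpa [measureReal_def] using hhalf)
    refine mul_le_mul' hinv ?_
    calc ∫⁻ m in A, κ m s ∂μ = ∫⁻ m in A, κ' m s ∂μ :=
          setLIntegral_congr_fun .of_discrete fun m hm => by rw [hκ m hm]
      _ ≤ ∫⁻ m, κ' m s ∂μ := setLIntegral_le_lintegral _ _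
  simpa [measureReal_def] using ENNReal.toReal_mono (by finiteness) hle

lemma isProbabilityMeasure_bind_edgeNumber {n : ℕ} {Ω : Type*} [MeasurableSpace Ω]
    {κ : ℕ → Measure Ω} (hκ : ∀ m : ℕ, (m : ℝ) ≤ d * n / 2 → IsProbabilityMeasure (κ m))
    (hhalf : 1 / 2 ≤ (poissonMeasure ((1 - ε) * d * n / 2).toNNReal).real
      {m : ℕ | (m : ℝ) ≤ d * n / 2}) :
    IsProbabilityMeasure ((edgeNumber ε d n).bind κ) := by
  have : IsProbabilityMeasure (edgeNumber ε d n) := cond_isProbabilityMeasure fun h0 => by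
    rw [measureReal_def, h0] at hhalf
    norm_num at hhalf
  exact isProbabilityMeasure_bind .of_discrete ((ae_cond_mem .of_discrete).mono hκ)

lemma abs_min_sub_min_le_mul_abs_sub {f : ℕ → ℝ} {N : ℕ} {r : ℝ} (hr : 0 ≤ r)
    (h : ∀ m < N, |f (m + 1) - f m| ≤ r) (m m' : ℕ) :
    |f (min m N) - f (min m' N)| ≤ r * |(m : ℝ) - m'| := by
  wlog hle : m ≤ m' generalizing m m'
  · rw [abs_sub_comm, abs_sub_comm (m : ℝ)]
    exact this m' m (le_of_not_ge hle)
  have hdist := dist_le_Ico_sum_of_dist_le (f := fun k => f (min k N)) hle (d := fun _ => r)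
    fun {k} _ _ => by
      rcases lt_or_ge k N with hk | hk
      · simpa [hk.le, Nat.succ_le_of_lt hk, Real.dist_eq, abs_sub_comm] using h k hk
      · simpa [hk, hk.trans k.le_succ] using hr
  rw [abs_sub_comm (m : ℝ), abs_of_nonneg (sub_nonneg.2 (Nat.cast_le.2 hle)), mul_comm]
  simpa [Real.dist_eq, Nat.cast_sub hle] using hdist

/-- The Poisson variable may be left unconditioned, because conditioning on an event of
probability at least `1 / 2` at most doubles the probability of a deviation. -/
lemma exponentiallySmall_deviationProb_bind_edgeNumber (hε : 0 < ε) (hε1 : ε ≤ 1) (hd : 0 < d)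
    {Ω : ℕ → Type*} [∀ n, MeasurableSpace (Ω n)] {X : ∀ n, Ω n → ℝ} (hX : ∀ n, Measurable (X n))
    {κ : ∀ n, ℕ → Measure (Ω n)} {a : ℕ → ℝ} {r v C : ℝ} (hr : 0 ≤ r) (hv : 0 ≤ v) (hC : 0 ≤ C)
    (hκ : ∀ᶠ n : ℕ in atTop, ∀ m : ℕ, (m : ℝ) ≤ d * n / 2 → IsProbabilityMeasure (κ n m) ∧
      HasLocalMGFBound (X n) r (v * n) (κ n m) ∧ ∀ᵐ ω ∂κ n m, |X n ω - a n| ≤ C * n)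
    (hstep : ∀ᶠ n : ℕ in atTop, ∀ m : ℕ, ((m + 1 : ℕ) : ℝ) ≤ d * n / 2 →
      |(κ n (m + 1))[X n] - (κ n m)[X n]| ≤ r) {δ : ℝ} (hδ : 0 < δ) :
    ExponentiallySmall atTop fun n =>
      deviationProb ((edgeNumber ε d n).bind (κ n)) (X n) (δ * n) := by
  set N : ℕ → ℕ := fun n => ⌊d * n / 2⌋₊
  have hle_floor {n m : ℕ} : (m : ℝ) ≤ d * n / 2 ↔ m ≤ N n :=
    (Nat.le_floor_iff (by positivity)).symm
  simp only [hle_floor] at hκ hstep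
  set μ : ℕ → Measure ℕ := fun n => poissonMeasure ((1 - ε) * d * n / 2).toNNReal
  set κ' : ∀ n, ℕ → Measure (Ω n) := fun n m => κ n (min m (N n))
  have hhalf := eventually_half_le_poissonMeasure hε hε1 hd
  have hprob : ∀ᶠ n in atTop, ∀ m, IsProbabilityMeasure (κ' n m) :=
    hκ.mono fun n hn m => (hn _ (min_le_right m (N n))).1
  refine exponentiallySmall_deviationProb_of_measureReal_le le_rfl hX (a := a) hC zero_le_two
    (k := 0) (ν := fun n => (μ n).bind (κ' n)) ?_ ?_ ?_ (fun s hs => ?_) hδ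
  · filter_upwards [hκ, hhalf] with n hn hhalf
    exact isProbabilityMeasure_bind_edgeNumber (fun m hm => (hn m (hle_floor.1 hm)).1) hhalf
  · filter_upwards [hκ, hprob] with n hn _
    refine ⟨isProbabilityMeasure_bind .of_discrete (ae_of_all _ inferInstance), ?_⟩
    exact Measure.ae_comp_of_ae_ae (κ := Kernel.ofFunOfCountable (κ' n))
      (measurableSet_le ((hX n).sub_const _).abs measurable_const)
      (ae_of_all _ fun m => (hn _ (min_le_right m (N n))).2.2)
  · filter_upwards [hprob, hhalf] with n _ hhalf s hs
    simpa using measureReal_bind_edgeNumber_le (fun m hm => by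
      simp only [κ', min_eq_left (hle_floor.1 hm)]) hhalf hs
  · have : 0 ≤ 1 - ε := by linarith
    refine exponentiallySmall_deviationProb_of_hasLocalMGFBound le_rfl hr
      (v := v + 2 * r ^ 2 * ((1 - ε) * d / 2)) (by positivity) ?_ hs
    filter_upwards [hκ, hstep, hprob] with n hn hstep _
    have hmeans : HasLocalMGFBound (fun m => (κ' n m)[X n]) r (2 * r ^ 2 * ((1 - ε) * d / 2 * n))
        (μ n) := by
      rw [← toNNReal_edgeNumber_mean hε1 hd]
      simpa only [one_mul] using (hasLocalMGFBound_poissonMeasure _).of_abs_sub_le_mul hr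
        .of_discrete (abs_min_sub_min_le_mul_abs_sub (f := fun m => (κ n m)[X n]) hr hstep)
    refine ⟨isProbabilityMeasure_bind .of_discrete (ae_of_all _ inferInstance), ?_⟩
    rw [add_mul, mul_assoc (2 * r ^ 2)]
    exact .bind (hX n) (fun m => (hn _ (min_le_right m (N n))).2.1) hmeans

end PoissonMixture

section IndependentEdges

instance (V : Type*) : MeasurableSpace (Sym2 V) := ⊤

instance (V : Type*) : DiscreteMeasurableSpace (Sym2 V) := ⟨fun _ => trivial⟩

open Classical in
/-- The law of a uniformly random pair of distinct vertices. -/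
noncomputable def uniformPair (n : ℕ) : Measure (Sym2 (Fin n)) :=
  uniformLaw {e | ¬ e.IsDiag} id

open Classical in
lemma exists_vertexPair {n : ℕ} (hn : 2 ≤ n) :
    (Finset.univ.filter fun e : Sym2 (Fin n) => ¬ e.IsDiag).Nonempty :=
  ⟨s(⟨0, by omega⟩, ⟨1, by omega⟩), by simp⟩

lemma isProbabilityMeasure_uniformPair {n : ℕ} (hn : 2 ≤ n) :
    IsProbabilityMeasure (uniformPair n) :=
  isProbabilityMeasure_uniformLaw id (exists_vertexPair hn)

lemma independentEdges_eq_map_pi {n : ℕ} (hn : 2 ≤ n) (m : ℕ) :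
    independentEdges n m = (Measure.pi fun _ : Fin m => uniformPair n).map Multigraph.ofEdges := by
  classical
  have hpi := pi_uniformLaw (ι := Fin m) (f := fun _ => (id : Sym2 (Fin n) → _))
    fun _ => exists_vertexPair hn
  simp only [uniformPair]
  rw [hpi, map_uniformLaw .of_discrete]
  rfl

lemma isProbabilityMeasure_independentEdges {n : ℕ} (hn : 2 ≤ n) (m : ℕ) :
    IsProbabilityMeasure (independentEdges n m) := by
  have := isProbabilityMeasure_uniformPair hn
  rw [independentEdges_eq_map_pi hn]
  exact Measure.isProbabilityMeasure_map Measurable.of_discrete.aemeasurable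

variable {q : ℕ} {β : ℝ}

lemma hasLocalMGFBound_independentEdges (hq : 1 ≤ q) (hβ : 0 ≤ β) {n : ℕ} (hn : 2 ≤ n) (m : ℕ) :
    HasLocalMGFBound (fun G => G.logZ q β) β (m * β ^ 2) (independentEdges n m) := by
  have := isProbabilityMeasure_uniformPair hn
  rw [independentEdges_eq_map_pi hn]
  refine HasLocalMGFBound.map .of_discrete .of_discrete ?_
  have h := hasLocalMGFBound_pi (fun _ : Fin m => uniformPair n) (fun _ => β ^ 2)
    (fun _ g hg hosc => .of_abs_sub_le hg hosc)
    (X := fun e => (Multigraph.ofEdges e).logZ q β) .of_discrete fun i e e' hee' => by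
      simpa using abs_logZ_ofEdges_sub_logZ_ofEdges_le hq hβ {i} (e := e) (e' := e')
        fun j hj => hee' j (Finset.notMem_singleton.1 hj)
  simpa using h

lemma map_tail_pi_uniformPair {n : ℕ} (hn : 2 ≤ n) (m : ℕ) :
    (Measure.pi fun _ : Fin (m + 1) => uniformPair n).map Fin.tail =
      Measure.pi fun _ : Fin m => uniformPair n := by
  have := isProbabilityMeasure_uniformPair hn
  exact (measurePreserving_snd.comp
    (measurePreserving_piFinSuccAbove (fun _ : Fin (m + 1) => uniformPair n) 0)).map_eq

lemma abs_integral_independentEdges_succ_sub_le (hq : 1 ≤ q) (hβ : 0 ≤ β) {n : ℕ} (hn : 2 ≤ n)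
    (m : ℕ) :
    |(independentEdges n (m + 1))[fun G => G.logZ q β] -
      (independentEdges n m)[fun G => G.logZ q β]| ≤ β := by
  have := isProbabilityMeasure_uniformPair hn
  rw [independentEdges_eq_map_pi hn, independentEdges_eq_map_pi hn, ← map_tail_pi_uniformPair hn m,
    Measure.map_map .of_discrete .of_discrete, integral_map Measurable.of_discrete.aemeasurable
    Measurable.of_discrete.aestronglyMeasurable, integral_map Measurable.of_discrete.aemeasurable
    Measurable.of_discrete.aestronglyMeasurable]
  exact abs_integral_sub_integral_le .of_finite .of_finite
    (abs_logZ_ofEdges_sub_logZ_ofEdges_tail_le hq hβ)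

lemma ae_independentEdges_abs_logZ_sub_le (hq : 1 ≤ q) (hβ : 0 ≤ β) (n m : ℕ) :
    ∀ᵐ G ∂independentEdges n m, |G.logZ q β - (⟨0⟩ : Multigraph (Fin n)).logZ q β| ≤ β * m :=
  ae_uniformLaw .of_discrete fun e _ => by
    simpa [Multigraph.ofEdges] using abs_logZ_sub_logZ_empty_le hq hβ (Multigraph.ofEdges e)

lemma exponentiallySmall_sparsifiedBinomial (hq : 1 ≤ q) {ε δ d : ℝ} (hε : 0 < ε) (hε1 : ε ≤ 1)
    (hδ : 0 < δ) (hβ : 0 ≤ β) (hd : 0 < d) :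
    ExponentiallySmall atTop fun n =>
      deviationProb (sparsifiedBinomial ε d n) (fun G => G.logZ q β) (δ * n) := by
  refine exponentiallySmall_deviationProb_bind_edgeNumber hε hε1 hd (fun _ => .of_discrete)
    (a := fun n => (⟨0⟩ : Multigraph (Fin n)).logZ q β) hβ (v := d / 2 * β ^ 2) (C := β * (d / 2))
    (by positivity) (by positivity) ?_ ?_ hδ
  · filter_upwards [eventually_ge_atTop 2] with n hn m hm
    refine ⟨isProbabilityMeasure_independentEdges hn m,
      (hasLocalMGFBound_independentEdges hq hβ hn m).mono ?_, ?_⟩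
    · linarith [mul_le_mul_of_nonneg_right hm (sq_nonneg β)]
    · filter_upwards [ae_independentEdges_abs_logZ_sub_le hq hβ n m] with G hG
      linarith [mul_le_mul_of_nonneg_left hm hβ]
  · filter_upwards [eventually_ge_atTop 2] with n hn m _
    exact abs_integral_independentEdges_succ_sub_le hq hβ hn m

end IndependentEdges

section BinomialGraph

/-- The graph whose edges are the pairs of distinct vertices at which the indicator `ω` holds. -/
noncomputable def graphOfIndicator {V : Type*} (ω : Sym2 V → Prop) : SimpleGraph V :=
  SimpleGraph.fromEdgeSet {e | ω e}

/-- The law of the indicator of the edge `e` in a binomial random graph with edge probability `p`.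
Diagonal pairs are never edges. -/
noncomputable def edgeIndicatorLaw {V : Type*} (p : unitInterval) (e : Sym2 V) : Measure Prop :=
  unitInterval.toNNReal p • Measure.dirac (¬ e.IsDiag) +
    unitInterval.toNNReal (unitInterval.symm p) • Measure.dirac False

instance {V : Type*} (p : unitInterval) (e : Sym2 V) :
    IsProbabilityMeasure (edgeIndicatorLaw p e) := by
  unfold edgeIndicatorLaw
  infer_instance

lemma hasLocalMGFBound_edgeIndicatorLaw {V : Type*} (p : unitInterval) (e : Sym2 V) {g : Prop → ℝ}
    {r : ℝ} (hg : ∀ a b, |g a - g b| ≤ r) :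
    HasLocalMGFBound g r (p * r ^ 2) (edgeIndicatorLaw p e) := by
  refine .of_integral_sq_le .of_discrete hg (g False) ?_
  have hsq := sq_le_sq' (abs_le.1 (hg (¬ e.IsDiag) False)).1 (abs_le.1 (hg (¬ e.IsDiag) False)).2
  rw [edgeIndicatorLaw, integral_add_measure .of_finite .of_finite, integral_smul_nnreal_measure,
    integral_smul_nnreal_measure, integral_dirac, integral_dirac, sub_self]
  simpa [NNReal.smul_def] using mul_le_mul_of_nonneg_left hsq p.2.1

instance (V : Type*) [Finite V] : DiscreteMeasurableSpace (SimpleGraph V) where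
  forall_measurableSet S := by
    rw [(Set.preimage_image_eq S SimpleGraph.edgeSet_injective).symm]
    exact SimpleGraph.measurable_edgeSet .of_discrete

lemma binomialGraph_eq_map_pi (d : ℝ) (n : ℕ) :
    binomialGraph d n = (Measure.pi fun e : Sym2 (Fin n) =>
      edgeIndicatorLaw (Set.projIcc (0 : ℝ) 1 zero_le_one (d / n)) e).map graphOfIndicator := by
  rw [binomialGraph, SimpleGraph.binomialRandom_eq_map, setBernoulli_eq_map,
    Measure.infinitePi_eq_pi, Measure.map_map (by fun_prop) (by fun_prop)]
  rfl

variable {q : ℕ} {β : ℝ}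

lemma abs_logZ_toMultigraph_sub_le {V : Type*} [Fintype V] (hq : 1 ≤ q) (hβ : 0 ≤ β)
    {G H : SimpleGraph V} (e : Sym2 V) (h : ∀ f ≠ e, f ∈ G.edgeSet ↔ f ∈ H.edgeSet) :
    |G.toMultigraph.logZ q β - H.toMultigraph.logZ q β| ≤ β := by
  classical
  have hsplit (K : SimpleGraph V) : K.toMultigraph =
      ⟨(K.edgeSet.toFinite.toFinset.filter (· ≠ e)).val +
        (K.edgeSet.toFinite.toFinset.filter fun f => ¬ f ≠ e).val⟩ := by
    simp only [SimpleGraph.toMultigraph, Finset.filter_val, Multiset.filter_add_not]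
  have hcard (K : SimpleGraph V) :
      (K.edgeSet.toFinite.toFinset.filter fun f => ¬ f ≠ e).val.card ≤ 1 :=
    Finset.card_le_one.2 fun a ha b hb => by simp_all
  have hne : G.edgeSet.toFinite.toFinset.filter (· ≠ e) =
      H.edgeSet.toFinite.toFinset.filter (· ≠ e) := by
    ext f
    simpa [and_congr_left_iff] using h f
  rw [hsplit G, hsplit H, hne]
  simpa using abs_logZ_add_sub_logZ_add_le hq hβ _ _ _ (hcard G) (hcard H)

lemma hasLocalMGFBound_binomialGraph (hq : 1 ≤ q) (hβ : 0 ≤ β) {d : ℝ} (hd : 0 < d) {n : ℕ}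
    (hn : 1 ≤ n) :
    HasLocalMGFBound (fun G => G.toMultigraph.logZ q β) β (d * β ^ 2 * n) (binomialGraph d n) := by
  set p := Set.projIcc (0 : ℝ) 1 zero_le_one (d / n) with hp
  have hn' : (1 : ℝ) ≤ n := by exact_mod_cast hn
  have hpd : (p : ℝ) ≤ d / n := by
    rw [hp, Set.coe_projIcc]
    exact max_le (by positivity) (min_le_right _ _)
  have hpairs : (((n + 1).choose 2 : ℕ) : ℝ) ≤ n * n := by
    rw [Nat.cast_choose_two]
    push_cast
    nlinarith
  have hpi := hasLocalMGFBound_pi (edgeIndicatorLaw (V := Fin n) p) (fun _ => p * β ^ 2)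
    (fun e g _ hg => hasLocalMGFBound_edgeIndicatorLaw p e hg)
    (X := fun ω => (graphOfIndicator ω).toMultigraph.logZ q β) .of_discrete
    fun e ω ω' h => abs_logZ_toMultigraph_sub_le hq hβ e fun f hf => by
      simp [graphOfIndicator, h f hf]
  rw [binomialGraph_eq_map_pi]
  refine (hpi.mono ?_).map .of_discrete .of_discrete
  calc ∑ _ : Sym2 (Fin n), (p : ℝ) * β ^ 2 = ((n + 1).choose 2 : ℕ) * (p * β ^ 2) := by
        simp [Sym2.card]
    _ ≤ n * n * (d / n * β ^ 2) := by
        gcongr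
        exact mul_nonneg p.2.1 (sq_nonneg β)
    _ = d * β ^ 2 * n := by field_simp

lemma exponentiallySmall_binomialGraph (hq : 1 ≤ q) {δ d : ℝ} (hδ : 0 < δ) (hβ : 0 ≤ β)
    (hd : 0 < d) :
    ExponentiallySmall atTop fun n =>
      deviationProb (binomialGraph d n) (fun G => G.toMultigraph.logZ q β) (δ * n) := by
  refine exponentiallySmall_deviationProb_of_hasLocalMGFBound le_rfl hβ
    (v := d * β ^ 2) (by positivity) ?_ hδ
  filter_upwards [eventually_ge_atTop 1] with n hn
  exact ⟨inferInstanceAs (IsProbabilityMeasure (SimpleGraph.binomialRandom _ _)),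
    hasLocalMGFBound_binomialGraph hq hβ hd hn⟩

end BinomialGraph

section Matchings

open Equiv

variable {X ι : Type*}

/-- The edge that joins the endpoints of the two half-edges with index `i`, if every half-edge `p`
is attached to the vertex `c p`. -/
def pairEdge (c : ι × Bool → X) (i : ι) : Sym2 X := s(c (i, false), c (i, true))

lemma mem_pairEdge {c : ι × Bool → X} {i : ι} {x : X} :
    x ∈ pairEdge c i ↔ ∃ b, c (i, b) = x := by
  simp [pairEdge, Sym2.mem_iff, eq_comm]

lemma pairEdge_injective (u : ι × Bool ↪ X) : Function.Injective (pairEdge u) := fun i j h => by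
  obtain ⟨b, hb⟩ := mem_pairEdge.1 (h ▸ mem_pairEdge.2 ⟨false, rfl⟩ : u (i, false) ∈ pairEdge u j)
  exact (congrArg Prod.fst (u.injective hb)).symm

lemma exists_pairEdge_eq (θ : ι → Sym2 X) : ∃ c : ι × Bool → X, pairEdge c = θ := by
  have hends (e : Sym2 X) : ∃ w : Bool → X, s(w false, w true) = e := by
    induction e with | _ x y
    exact ⟨fun b => bif b then y else x, rfl⟩
  choose w hw using hends
  exact ⟨fun p => w (θ p.1) p.2, funext fun i => hw (θ i)⟩

/-- The matching that joins the two points with the same first index of an injective family. -/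
def matchingOf [Fintype ι] (u : ι × Bool ↪ X) : Finset (Sym2 X) :=
  Finset.univ.map ⟨_, pairEdge_injective u⟩

lemma matchingOf_trans [Fintype ι] (u : ι × Bool ↪ X) (π : Perm X) :
    matchingOf (u.trans π.toEmbedding) = (matchingOf u).map π.toEmbedding.sym2Map := by
  ext e
  simp [matchingOf, pairEdge]

lemma exists_perm_comp_eq [Finite X] (u v : ι ↪ X) :
    ∃ π : Perm X, u.trans π.toEmbedding = v := by
  classical
  have := Fintype.ofFinite X
  let e := (ofInjective u u.injective).symm.trans (ofInjective v v.injective)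
  refine ⟨e.extendSubtype, Function.Embedding.ext fun i => ?_⟩
  have hi : (⟨u i, i, rfl⟩ : Set.range u) = ofInjective u u.injective i := rfl
  change e.extendSubtype (u i) = v i
  rw [extendSubtype_apply_of_mem _ _ ⟨i, rfl⟩, hi]
  simp [e]

variable [Fintype X] {m : ℕ}

lemma mem_matchings {M : Finset (Sym2 X)} : M ∈ matchings X m ↔
    M.card = m ∧ (∀ e ∈ M, ¬ e.IsDiag) ∧ ∀ e ∈ M, ∀ f ∈ M, e ≠ f → ∀ x ∈ e, x ∉ f := by
  simp only [matchings, Finset.mem_filter_univ]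

lemma matchingOf_mem_matchings (u : Fin m × Bool ↪ X) : matchingOf u ∈ matchings X m := by
  simp only [mem_matchings, matchingOf, Finset.card_map, Finset.card_univ, Fintype.card_fin,
    Finset.forall_mem_map, Finset.mem_univ, Function.Embedding.coeFn_mk, mem_pairEdge,
    true_and, forall_const]
  refine ⟨by simp [pairEdge], ?_⟩
  rintro i j hij x ⟨b, rfl⟩ ⟨b', h⟩
  exact hij (congrArg (pairEdge u) (congrArg Prod.fst (u.injective h)).symm)

lemma exists_matchingOf_eq {M : Finset (Sym2 X)} (hM : M ∈ matchings X m) :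
    ∃ u : Fin m × Bool ↪ X, matchingOf u = M := by
  obtain ⟨hcard, hdiag, hdisj⟩ := mem_matchings.1 hM
  let θ : Fin m ≃ M := (M.equivFinOfCardEq hcard).symm
  obtain ⟨c, hc⟩ := exists_pairEdge_eq fun i => (θ i).1
  have hmem (p : Fin m × Bool) : c p ∈ (θ p.1).1 := congrFun hc p.1 ▸ mem_pairEdge.2 ⟨p.2, rfl⟩
  have hinj : Function.Injective c := by
    rintro ⟨i, b⟩ ⟨j, b'⟩ h
    obtain rfl : i = j := by_contra fun hij =>
      hdisj _ (θ i).2 _ (θ j).2 (fun h => hij (θ.injective (Subtype.ext h))) _ (hmem (i, b))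
        (h ▸ hmem (j, b'))
    have hne : ¬ (pairEdge c i).IsDiag := congrFun hc i ▸ hdiag _ (θ i).2
    rw [pairEdge, Sym2.mk_isDiag_iff] at hne
    cases b <;> cases b' <;> simp_all
  refine ⟨⟨c, hinj⟩, Finset.ext fun e => ?_⟩
  simp only [matchingOf, Finset.mem_map, Finset.mem_univ, true_and, Function.Embedding.coeFn_mk, hc]
  exact ⟨fun ⟨i, hi⟩ => hi ▸ (θ i).2, fun he => ⟨θ.symm ⟨e, he⟩, by simp⟩⟩

lemma uniformLaw_matchings [DecidableEq X] (u : Fin m × Bool ↪ X) {Ω : Type*} [MeasurableSpace Ω]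
    (f : Finset (Sym2 X) → Ω) :
    uniformLaw (matchings X m) f =
      uniformLaw Finset.univ fun π : Perm X => f (matchingOf (u.trans π.toEmbedding)) := by
  refine (uniformLaw_comp_of_card_fiber_eq (c := (Finset.univ.filter fun π : Perm X =>
    matchingOf (u.trans π.toEmbedding) = matchingOf u).card) f ?_
    (fun π _ => matchingOf_mem_matchings _) fun M hM => ?_).symm
  · exact Finset.card_ne_zero_of_mem (Finset.mem_filter.2 ⟨Finset.mem_univ 1, rfl⟩)
  · obtain ⟨v, rfl⟩ := exists_matchingOf_eq hM
    obtain ⟨τ, rfl⟩ := exists_perm_comp_eq u v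
    refine Finset.card_equiv (Equiv.mulLeft τ⁻¹) fun π => ?_
    have hπ : u.trans π.toEmbedding = (u.trans (τ⁻¹ * π).toEmbedding).trans τ.toEmbedding := by
      ext i
      simp
    simp only [Finset.mem_filter_univ, Equiv.coe_mulLeft]
    rw [hπ, matchingOf_trans _ τ, matchingOf_trans u τ, Finset.map_inj]

end Matchings

section ConfigurationModel

/-- The multigraph that arises by joining the two half-edges with the same index, if every half-edge
`p` is attached to the vertex `c p`. -/
def pairedGraph {V ι : Type*} [Fintype ι] (c : ι × Bool → V) : Multigraph V :=
  Multigraph.ofEdges (pairEdge c)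

lemma abs_logZ_pairedGraph_swap_mul_sub_le {q : ℕ} {β : ℝ} (hq : 1 ≤ q) (hβ : 0 ≤ β)
    {V X ι : Type*} [Fintype V] [DecidableEq X] [Fintype ι] (l : X → V) (u : ι × Bool ↪ X)
    (π : Equiv.Perm X) (a b : X) :
    |(pairedGraph fun p => l ((Equiv.swap a b * π) (u p))).logZ q β -
      (pairedGraph fun p => l (π (u p))).logZ q β| ≤ 2 * β := by
  classical
  let w : ι × Bool ↪ X := u.trans π.toEmbedding
  let T : Finset ι := (({a, b} : Finset X).preimage w w.injective.injOn).image Prod.fst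
  have hT : T.card ≤ 2 :=
    calc T.card ≤ (({a, b} : Finset X).preimage w w.injective.injOn).card := Finset.card_image_le
      _ ≤ ({a, b} : Finset X).card :=
        Finset.card_le_card_of_injOn w (fun p => Finset.mem_preimage.1) w.injective.injOn
      _ ≤ 2 := Finset.card_le_two
  have hswap (i : ι) (hi : i ∉ T) (b' : Bool) :
      (Equiv.swap a b * π) (u (i, b')) = π (u (i, b')) := by
    have hmem : π (u (i, b')) ∉ ({a, b} : Finset X) := fun h =>
      hi (Finset.mem_image.2 ⟨(i, b'), Finset.mem_preimage.2 h, rfl⟩)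
    rw [Finset.mem_insert, Finset.mem_singleton, not_or] at hmem
    exact Equiv.swap_apply_of_ne_of_ne hmem.1 hmem.2
  calc _ ≤ β * T.card := abs_logZ_ofEdges_sub_logZ_ofEdges_le hq hβ T fun i hi => by
        simp only [pairEdge, hswap i hi]
    _ ≤ β * 2 := by gcongr; exact_mod_cast hT
    _ = 2 * β := mul_comm _ _

variable {d n m : ℕ}

lemma two_mul_le_of_cast_le (h : (m : ℝ) ≤ d * n / 2) : 2 * m ≤ n * d := by
  have h' : (2 * m : ℝ) ≤ n * d := by linarith
  exact_mod_cast h'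

lemma nonempty_halfEdge_embedding (h : 2 * m ≤ n * d) :
    Nonempty (Fin m × Bool ↪ Fin n × Fin d) :=
  Function.Embedding.nonempty_of_card_le (by simpa [mul_comm] using h)

lemma configurationModel_eq_map_perm (u : Fin m × Bool ↪ Fin n × Fin d) :
    configurationModel d n m =
      (uniformLaw Finset.univ id : Measure (Equiv.Perm (Fin n × Fin d))).map
        fun π => pairedGraph fun p => (π (u p)).1 := by
  rw [configurationModel, uniformLaw_matchings u, map_uniformLaw .of_discrete]
  simp only [matchingOf, Finset.map_val, Multiset.map_map]
  rfl

lemma isProbabilityMeasure_configurationModel (u : Fin m × Bool ↪ Fin n × Fin d) :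
    IsProbabilityMeasure (configurationModel d n m) :=
  isProbabilityMeasure_uniformLaw _ ⟨_, matchingOf_mem_matchings u⟩

variable {q : ℕ} {β : ℝ}

lemma hasLocalMGFBound_configurationModel (hq : 1 ≤ q) (hβ : 0 ≤ β)
    (u : Fin m × Bool ↪ Fin n × Fin d) :
    HasLocalMGFBound (fun G => G.logZ q β) (4 * β) (d * (4 * β) ^ 2 * n)
      (configurationModel d n m) := by
  rw [configurationModel_eq_map_perm u]
  refine HasLocalMGFBound.map .of_discrete .of_discrete ?_
  have h := hasLocalMGFBound_perm (c := 2 * β)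
    (X := fun π => (pairedGraph fun p => (π (u p)).1).logZ q β)
    (abs_logZ_pairedGraph_swap_mul_sub_le hq hβ Prod.fst u)
  convert h using 1
  · ring
  · simp only [Fintype.card_prod, Fintype.card_fin, Nat.cast_mul]
    ring

lemma abs_integral_configurationModel_succ_sub_le (hq : 1 ≤ q) (hβ : 0 ≤ β)
    (u : Fin (m + 1) × Bool ↪ Fin n × Fin d) :
    |(configurationModel d n (m + 1))[fun G => G.logZ q β] -
      (configurationModel d n m)[fun G => G.logZ q β]| ≤ β := by
  have := isProbabilityMeasure_uniformLaw (id : Equiv.Perm (Fin n × Fin d) → _)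
    Finset.univ_nonempty
  let v : Fin m × Bool ↪ Fin n × Fin d :=
    ((Fin.succEmb m).prodMap (Function.Embedding.refl Bool)).trans u
  rw [configurationModel_eq_map_perm u, configurationModel_eq_map_perm v,
    integral_map Measurable.of_discrete.aemeasurable Measurable.of_discrete.aestronglyMeasurable,
    integral_map Measurable.of_discrete.aemeasurable Measurable.of_discrete.aestronglyMeasurable]
  exact abs_integral_sub_integral_le .of_finite .of_finite fun π =>
    abs_logZ_ofEdges_sub_logZ_ofEdges_tail_le hq hβ _

lemma ae_configurationModel_abs_logZ_sub_le (hq : 1 ≤ q) (hβ : 0 ≤ β) (d n m : ℕ) :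
    ∀ᵐ G ∂configurationModel d n m, |G.logZ q β - (⟨0⟩ : Multigraph (Fin n)).logZ q β| ≤ β * m :=
  ae_uniformLaw .of_discrete fun M hM => by
    simpa [(mem_matchings.1 hM).1] using
      abs_logZ_sub_logZ_empty_le hq hβ (⟨M.val.map (Sym2.map Prod.fst)⟩ : Multigraph (Fin n))

lemma exponentiallySmall_sparsifiedRegular (hq : 1 ≤ q) {ε δ : ℝ} (hε : 0 < ε) (hε1 : ε ≤ 1)
    (hδ : 0 < δ) (hβ : 0 ≤ β) (hd : 1 ≤ d) :
    ExponentiallySmall atTop fun n =>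
      deviationProb (sparsifiedRegular ε d n) (fun G => G.logZ q β) (δ * n) := by
  refine exponentiallySmall_deviationProb_bind_edgeNumber hε hε1 (by exact_mod_cast hd)
    (fun _ => .of_discrete) (a := fun n => (⟨0⟩ : Multigraph (Fin n)).logZ q β) (r := 4 * β)
    (by positivity) (v := d * (4 * β) ^ 2) (C := β * (d / 2)) (by positivity) (by positivity)
    (.of_forall fun n m hm => ?_) (.of_forall fun n m hm => ?_) hδ
  · obtain ⟨u⟩ := nonempty_halfEdge_embedding (two_mul_le_of_cast_le hm)
    refine ⟨isProbabilityMeasure_configurationModel u, hasLocalMGFBound_configurationModel hq hβ u,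
      ?_⟩
    filter_upwards [ae_configurationModel_abs_logZ_sub_le hq hβ d n m] with G hG
    linarith [mul_le_mul_of_nonneg_left hm hβ]
  · obtain ⟨u⟩ := nonempty_halfEdge_embedding (two_mul_le_of_cast_le hm)
    exact (abs_integral_configurationModel_succ_sub_le hq hβ u).trans (by linarith)

end ConfigurationModel

section Darts

variable {J V : Type*}

/-- The other half of the pair to which the half-edge `p` belongs. -/
def oppEnd (p : J × Bool) : J × Bool := (p.1, !p.2)

@[simp]
lemma oppEnd_oppEnd (p : J × Bool) : oppEnd (oppEnd p) = p := by simp [oppEnd]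

lemma oppEnd_ne_self (p : J × Bool) : oppEnd p ≠ p := fun h => by
  simpa [oppEnd] using congrArg Prod.snd h

lemma oppEnd_injective : Function.Injective (oppEnd : J × Bool → J × Bool) :=
  Function.Involutive.injective oppEnd_oppEnd

/-- The oriented edge on which the half-edge `p` leaves its endpoint, if every half-edge `p` is
attached to the vertex `c p`. -/
def dart (c : J × Bool → V) (p : J × Bool) : V × V := (c p, c (oppEnd p))

@[simp]
lemma dart_oppEnd (c : J × Bool → V) (p : J × Bool) : dart c (oppEnd p) = (dart c p).swap := by
  simp [dart]

variable [Fintype J] [DecidableEq V]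

/-- The vertices that are equal to `v` or joined to it by a dart. -/
def closedNeighbors (c : J × Bool → V) (v : V) : Finset V :=
  insert v ((Finset.univ.filter fun p => c p = v).image fun p => c (oppEnd p))

lemma card_closedNeighbors_le {c : J × Bool → V} {d : ℕ}
    (hc : ∀ v, (Finset.univ.filter fun p => c p = v).card ≤ d) (v : V) :
    (closedNeighbors c v).card ≤ d + 1 :=
  (Finset.card_insert_le _ _).trans
    (Nat.add_le_add_right (Finset.card_image_le.trans (hc v)) 1)

lemma dart_ne_of_notMem_closedNeighbors {c : J × Bool → V} {v w : V} (h : w ∉ closedNeighbors c v)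
    (p : J × Bool) : dart c p ≠ (v, w) := fun hp =>
  h (Finset.mem_insert_of_mem (Finset.mem_image.2
    ⟨p, Finset.mem_filter.2 ⟨Finset.mem_univ p, congrArg Prod.fst hp⟩, congrArg Prod.snd hp⟩))

variable [DecidableEq J]

/-- The half-edges whose dart occurs more than once. They lie on loops and multiple edges. -/
def badPoints (c : J × Bool → V) : Finset (J × Bool) :=
  {p | ∃ p', p' ≠ p ∧ dart c p' = dart c p}

lemma mem_badPoints {c : J × Bool → V} {p : J × Bool} :
    p ∈ badPoints c ↔ ∃ p', p' ≠ p ∧ dart c p' = dart c p :=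
  Finset.mem_filter_univ _

lemma oppEnd_mem_badPoints {c : J × Bool → V} {p : J × Bool} :
    oppEnd p ∈ badPoints c ↔ p ∈ badPoints c := by
  have h (p) (hp : p ∈ badPoints c) : oppEnd p ∈ badPoints c := by
    obtain ⟨p', hne, hp'⟩ := mem_badPoints.1 hp
    exact mem_badPoints.2 ⟨oppEnd p', oppEnd_injective.ne hne, by simp [hp']⟩
  exact ⟨fun hp => oppEnd_oppEnd p ▸ h _ hp, h p⟩

lemma badPoints_eq_empty_iff {c : J × Bool → V} :
    badPoints c = ∅ ↔ Function.Injective (dart c) := by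
  simp only [Finset.eq_empty_iff_forall_notMem, mem_badPoints, not_exists, not_and]
  exact ⟨fun h p p' hp => by_contra fun hne => h p' p hne hp, fun h p p' hne hp => hne (h hp)⟩

end Darts

section Switching

open Equiv

variable {J V : Type*} [DecidableEq J] {c : J × Bool → V} {x z : J × Bool}

lemma dart_comp_swap_left (hxz : oppEnd x ≠ z) : dart (c ∘ swap x z) x = (c z, c (oppEnd x)) := by
  simp [dart, swap_apply_of_ne_of_ne (oppEnd_ne_self x) hxz]

lemma dart_comp_swap_of_ne {w : J × Bool} (hx : w ≠ x) (hz : w ≠ z) (hx' : w ≠ oppEnd x)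
    (hz' : w ≠ oppEnd z) : dart (c ∘ swap x z) w = dart c w := by
  have hx'' : oppEnd w ≠ x := fun h => hx' (by rw [← h, oppEnd_oppEnd])
  have hz'' : oppEnd w ≠ z := fun h => hz' (by rw [← h, oppEnd_oppEnd])
  simp [dart, swap_apply_of_ne_of_ne hx hz, swap_apply_of_ne_of_ne hx'' hz'']

variable [Fintype J] [DecidableEq V]

lemma notMem_badPoints_comp_swap (hne : c x ≠ c z) (hx : c x ≠ c (oppEnd z))
    (hz : c z ≠ c (oppEnd x)) (hloop : c x ≠ c (oppEnd x) ∨ c z ≠ c (oppEnd z))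
    (hdart : ∀ w, dart c w ≠ (c z, c (oppEnd x))) : x ∉ badPoints (c ∘ swap x z) := by
  have hxz : oppEnd x ≠ z := fun h => hz (by rw [h])
  have hzx : oppEnd z ≠ x := fun h => hx (by rw [h])
  have hdx := dart_comp_swap_left (c := c) hxz
  have hdz : dart (c ∘ swap x z) z = (c x, c (oppEnd z)) := by
    rw [swap_comm, dart_comp_swap_left hzx]
  rw [mem_badPoints, hdx]
  rintro ⟨w, hwx, hw⟩
  by_cases hwz : w = z
  · rw [hwz, hdz] at hw
    exact hne (congrArg Prod.fst hw)
  by_cases hwx' : w = oppEnd x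
  · rw [hwx', dart_oppEnd, hdx] at hw
    exact hz (congrArg Prod.snd hw)
  by_cases hwz' : w = oppEnd z
  · rw [hwz', dart_oppEnd, hdz] at hw
    exact hloop.elim (fun h => h (congrArg Prod.snd hw)) fun h => h (congrArg Prod.fst hw).symm
  · rw [dart_comp_swap_of_ne hwx hwz hwx' hwz'] at hw
    exact hdart w hw

lemma card_badPoints_comp_swap_lt (hx : x ∈ badPoints c) (hz : z ∉ badPoints c)
    (hne : c z ≠ c x) (hzx : c z ≠ c (oppEnd x)) (hxz : c (oppEnd z) ≠ c x)
    (hdx : ∀ w, dart c w ≠ (c z, c (oppEnd x))) (hdz : ∀ w, dart c w ≠ (c x, c (oppEnd z))) :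
    (badPoints (c ∘ swap x z)).card < (badPoints c).card := by
  have hloop : c z ≠ c (oppEnd z) := fun h =>
    hz (mem_badPoints.2 ⟨oppEnd z, oppEnd_ne_self z, by simp [dart, h]⟩)
  have hx_good : x ∉ badPoints (c ∘ swap x z) :=
    notMem_badPoints_comp_swap hne.symm hxz.symm hzx (.inr hloop) hdx
  have hz_good : z ∉ badPoints (c ∘ swap x z) := by
    rw [swap_comm]
    exact notMem_badPoints_comp_swap hne hzx hxz.symm (.inl hloop) hdz
  have hdart (w) (hw : w ∈ badPoints (c ∘ swap x z)) : dart (c ∘ swap x z) w = dart c w := by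
    refine dart_comp_swap_of_ne ?_ ?_ ?_ ?_ <;> rintro rfl
    · exact hx_good hw
    · exact hz_good hw
    · exact hx_good (oppEnd_mem_badPoints.1 hw)
    · exact hz_good (oppEnd_mem_badPoints.1 hw)
  refine Finset.card_lt_card ((Finset.ssubset_iff_of_subset fun w hw => ?_).2 ⟨x, hx, hx_good⟩)
  obtain ⟨w', hne', hw'⟩ := mem_badPoints.1 hw
  have hbad' : w' ∈ badPoints (c ∘ swap x z) := mem_badPoints.2 ⟨w, hne'.symm, hw'.symm⟩
  exact mem_badPoints.2 ⟨w', hne', by rw [← hdart w hw, ← hdart w' hbad', hw']⟩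

variable {d : ℕ}

lemma card_filter_mem_le {X : Type*} [Fintype X] {c : X → V}
    (hc : ∀ v, (Finset.univ.filter fun p => c p = v).card ≤ d) (T : Finset V) :
    (Finset.univ.filter fun p => c p ∈ T).card ≤ T.card * d := by
  classical
  calc _ ≤ (T.biUnion fun v => Finset.univ.filter fun p => c p = v).card :=
        Finset.card_le_card fun p hp => by simpa using hp
    _ ≤ ∑ v ∈ T, (Finset.univ.filter fun p => c p = v).card := Finset.card_biUnion_le
    _ ≤ T.card * d := by simpa using Finset.sum_le_card_nsmul T _ d fun v _ => hc v

lemma exists_card_badPoints_comp_swap_lt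
    (hc : ∀ v, (Finset.univ.filter fun p => c p = v).card ≤ d)
    (hcard : d * (2 * d + 3) + (badPoints c).card < Fintype.card (J × Bool))
    (hx : x ∈ badPoints c) :
    ∃ z, (badPoints (c ∘ swap x z)).card < (badPoints c).card := by
  let A : Finset (J × Bool) := Finset.univ.filter fun z =>
    c z ∈ insert (c x) (closedNeighbors c (c (oppEnd x)))
  let B : Finset (J × Bool) := Finset.univ.filter fun z => c (oppEnd z) ∈ closedNeighbors c (c x)
  have hA : A.card ≤ (d + 1 + 1) * d := (card_filter_mem_le hc _).trans (by
    gcongr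
    exact (Finset.card_insert_le _ _).trans (by gcongr; exact card_closedNeighbors_le hc _))
  have hB : B.card ≤ (d + 1) * d :=
    calc B.card ≤ (Finset.univ.filter fun z => c z ∈ closedNeighbors c (c x)).card :=
          Finset.card_le_card_of_injOn oppEnd (fun z hz => by simpa [B] using hz)
            oppEnd_injective.injOn
      _ ≤ (d + 1) * d := (card_filter_mem_le hc _).trans (by
          gcongr; exact card_closedNeighbors_le hc _)
  have hunion : (badPoints c ∪ (A ∪ B)).card < (Finset.univ : Finset (J × Bool)).card :=
    calc _ ≤ (badPoints c).card + ((d + 1 + 1) * d + (d + 1) * d) :=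
          (Finset.card_union_le _ _).trans (add_le_add le_rfl
            ((Finset.card_union_le _ _).trans (add_le_add hA hB)))
      _ = d * (2 * d + 3) + (badPoints c).card := by ring
      _ < _ := hcard
  obtain ⟨z, -, hz⟩ := Finset.exists_mem_notMem_of_card_lt_card hunion
  simp only [A, B, Finset.mem_union, Finset.mem_filter_univ, Finset.mem_insert, not_or] at hz
  obtain ⟨hz, ⟨hzx, hzA⟩, hzB⟩ := hz
  refine ⟨z, card_badPoints_comp_swap_lt hx hz hzx (fun h => hzA (h ▸ Finset.mem_insert_self _ _))
    (fun h => hzB (h ▸ Finset.mem_insert_self _ _)) (fun w hw => ?_)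
    (dart_ne_of_notMem_closedNeighbors hzB)⟩
  refine dart_ne_of_notMem_closedNeighbors hzA (oppEnd w) ?_
  rw [dart_oppEnd, hw, Prod.swap_prod_mk]

end Switching

section FirstMoment

open Equiv

section SameLabel

variable {X V : Type*} [Fintype X] [DecidableEq X] [DecidableEq V] {l : X → V} {d : ℕ}

lemma card_mul_card_filter_same_label_le
    (hl : ∀ v, (Finset.univ.filter fun p => l p = v).card ≤ d) (Q : Perm X → Prop)
    [DecidablePred Q] {x z : X} {U : Finset X} (hx : x ∉ U) (hxz : x ≠ z)
    (hQ : ∀ u ∈ U, ∀ σ, Q σ → Q (σ * swap z u)) :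
    U.card * (Finset.univ.filter fun σ : Perm X => Q σ ∧ l (σ x) = l (σ z)).card ≤
      d * (Finset.univ.filter Q).card := by
  have hswap (u) (hu : u ∈ U) :
      (Finset.univ.filter fun σ : Perm X => Q σ ∧ l (σ x) = l (σ z)).card ≤
        (Finset.univ.filter fun σ : Perm X => Q σ ∧ l (σ x) = l (σ u)).card := by
    refine Finset.card_le_card_of_injOn (· * swap z u) (fun σ hσ => ?_)
      (mul_left_injective (swap z u)).injOn
    simp only [Finset.coe_filter_univ, Set.mem_ofPred_eq] at hσ ⊢
    have hxu : x ≠ u := fun h => hx (h ▸ hu)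
    exact ⟨hQ u hu σ hσ.1, by simp [swap_apply_of_ne_of_ne hxz hxu, hσ.2]⟩
  have hfiber (σ : Perm X) : (U.filter fun u => l (σ x) = l (σ u)).card ≤ d :=
    (Finset.card_le_card_of_injOn σ (fun u hu => by simp_all [eq_comm])
      σ.injective.injOn).trans (hl (l (σ x)))
  calc U.card * _
      ≤ ∑ u ∈ U, (Finset.univ.filter fun σ : Perm X => Q σ ∧ l (σ x) = l (σ u)).card := by
        simpa using Finset.card_nsmul_le_sum U _ _ hswap
    _ = ∑ σ ∈ Finset.univ.filter Q, (U.filter fun u => l (σ x) = l (σ u)).card := by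
        simp only [← Finset.filter_filter]
        exact Finset.sum_card_bipartiteAbove_eq_sum_card_bipartiteBelow
          fun u (σ : Perm X) => l (σ x) = l (σ u)
    _ ≤ d * (Finset.univ.filter Q).card := by
        simpa [mul_comm] using Finset.sum_le_card_nsmul _ _ d fun σ _ => hfiber σ

lemma card_filter_same_label_le (hl : ∀ v, (Finset.univ.filter fun p => l p = v).card ≤ d)
    {x z : X} (hxz : x ≠ z) :
    (Fintype.card X - 1) * (Finset.univ.filter fun σ : Perm X => l (σ x) = l (σ z)).card ≤
      d * (Fintype.card X).factorial := by
  simpa [Finset.card_erase_of_mem, Fintype.card_perm] using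
    card_mul_card_filter_same_label_le hl (fun _ => True) (Finset.notMem_erase x Finset.univ) hxz
      (by simp)

end SameLabel

variable {J V : Type*} [Fintype J] [DecidableEq J] [DecidableEq V] {l : J × Bool → V} {d : ℕ}

lemma card_filter_loop_le (hl : ∀ v, (Finset.univ.filter fun p => l p = v).card ≤ d)
    (x : J × Bool) :
    (Fintype.card (J × Bool) - 1) * (Finset.univ.filter fun σ : Perm (J × Bool) =>
      dart (l ∘ σ) (oppEnd x) = dart (l ∘ σ) x).card ≤
      d * (Fintype.card (J × Bool)).factorial := by
  refine le_trans ?_ (card_filter_same_label_le hl (oppEnd_ne_self x))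
  gcongr with σ
  exact fun h => congrArg Prod.fst h

lemma card_filter_parallel_le (hl : ∀ v, (Finset.univ.filter fun p => l p = v).card ≤ d)
    {x y : J × Bool} (hyx : y ≠ x) (hyx' : y ≠ oppEnd x) :
    (Fintype.card (J × Bool) - 1) * ((Fintype.card (J × Bool) - 3) *
      (Finset.univ.filter fun σ : Perm (J × Bool) => dart (l ∘ σ) y = dart (l ∘ σ) x).card) ≤
      d ^ 2 * (Fintype.card (J × Bool)).factorial := by
  have hopp : oppEnd x ≠ oppEnd y := oppEnd_injective.ne hyx.symm
  let U : Finset (J × Bool) := Finset.univ \ {x, oppEnd x, oppEnd y}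
  have hU : Fintype.card (J × Bool) - 3 ≤ U.card := by
    rw [Finset.card_univ_sdiff]
    exact Nat.sub_le_sub_left Finset.card_le_three _
  have hcond := card_mul_card_filter_same_label_le hl (U := U) (x := x) (z := y)
    (fun σ => l (σ (oppEnd x)) = l (σ (oppEnd y))) (by simp [U]) hyx.symm fun u hu σ hσ => by
      simp only [U, Finset.mem_sdiff, Finset.mem_univ, true_and, Finset.mem_insert,
        Finset.mem_singleton, not_or] at hu
      simpa [swap_apply_of_ne_of_ne hyx'.symm (Ne.symm hu.2.1),
        swap_apply_of_ne_of_ne (oppEnd_ne_self y) (Ne.symm hu.2.2)] using hσ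
  have hsub : (Finset.univ.filter fun σ : Perm (J × Bool) => dart (l ∘ σ) y = dart (l ∘ σ) x) ⊆
      Finset.univ.filter fun σ : Perm (J × Bool) =>
        l (σ (oppEnd x)) = l (σ (oppEnd y)) ∧ l (σ x) = l (σ y) := by
    intro σ hσ
    simp only [Finset.mem_filter_univ, dart, Prod.mk.injEq] at hσ ⊢
    exact ⟨hσ.2.symm, hσ.1.symm⟩
  calc _ ≤ (Fintype.card (J × Bool) - 1) * (d * (Finset.univ.filter fun σ : Perm (J × Bool) =>
        l (σ (oppEnd x)) = l (σ (oppEnd y))).card) :=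
        Nat.mul_le_mul le_rfl ((Nat.mul_le_mul hU (Finset.card_le_card hsub)).trans hcond)
    _ = d * ((Fintype.card (J × Bool) - 1) * (Finset.univ.filter fun σ : Perm (J × Bool) =>
        l (σ (oppEnd x)) = l (σ (oppEnd y))).card) := by ring
    _ ≤ d * (d * (Fintype.card (J × Bool)).factorial) :=
        Nat.mul_le_mul le_rfl (card_filter_same_label_le hl hopp)
    _ = _ := by ring

lemma card_badPoints_le_sum (c : J × Bool → V) :
    (badPoints c).card ≤
      ∑ x, ∑ y ∈ Finset.univ.erase x, if dart c y = dart c x then 1 else 0 := by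
  rw [badPoints, Finset.card_filter]
  refine Finset.sum_le_sum fun x _ => ?_
  split_ifs with h
  · obtain ⟨y, hyx, hy⟩ := h
    exact (if_pos hy).symm.le.trans (Finset.single_le_sum
      (f := fun y => if dart c y = dart c x then 1 else 0) (fun _ _ => Nat.zero_le _)
      (Finset.mem_erase.2 ⟨hyx, Finset.mem_univ y⟩))
  · exact Nat.zero_le _

lemma sum_card_filter_dart_eq_le (hl : ∀ v, (Finset.univ.filter fun p => l p = v).card ≤ d)
    (hN : 6 ≤ Fintype.card (J × Bool)) (x : J × Bool) :
    Fintype.card (J × Bool) * ∑ y ∈ Finset.univ.erase x, (Finset.univ.filter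
      fun σ : Perm (J × Bool) => dart (l ∘ σ) y = dart (l ∘ σ) x).card ≤
      (2 * d + 4 * d ^ 2) * (Fintype.card (J × Bool)).factorial := by
  set N := Fintype.card (J × Bool)
  have hN1 : N ≤ 2 * (N - 1) := by lia
  have hN3 : N ≤ 2 * (N - 3) := by lia
  rw [← Finset.add_sum_erase _ _ (Finset.mem_erase.2 ⟨oppEnd_ne_self x, Finset.mem_univ _⟩),
    mul_add, add_mul]
  refine add_le_add ?_ ?_
  · calc _ ≤ 2 * (N - 1) * _ := Nat.mul_le_mul_right _ hN1
      _ ≤ 2 * (d * N.factorial) := by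
        rw [mul_assoc]
        exact Nat.mul_le_mul_left 2 (card_filter_loop_le hl x)
      _ = 2 * d * N.factorial := (mul_assoc _ _ _).symm
  refine Nat.le_of_mul_le_mul_left (c := N) ?_ (by lia)
  calc _ = ∑ y ∈ (Finset.univ.erase x).erase (oppEnd x), N * (N * (Finset.univ.filter
        fun σ : Perm (J × Bool) => dart (l ∘ σ) y = dart (l ∘ σ) x).card) := by
        simp only [Finset.mul_sum]
    _ ≤ ∑ _y ∈ (Finset.univ.erase x).erase (oppEnd x), 4 * d ^ 2 * N.factorial := by
        refine Finset.sum_le_sum fun y hy => ?_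
        rw [Finset.mem_erase, Finset.mem_erase] at hy
        calc _ ≤ 2 * (N - 1) * (2 * (N - 3) * _) :=
              Nat.mul_le_mul hN1 (Nat.mul_le_mul_right _ hN3)
          _ = 4 * ((N - 1) * ((N - 3) * _)) := by ring
          _ ≤ 4 * (d ^ 2 * N.factorial) :=
              Nat.mul_le_mul_left 4 (card_filter_parallel_le hl hy.2.1 hy.1)
          _ = _ := (mul_assoc _ _ _).symm
    _ ≤ N * (4 * d ^ 2 * N.factorial) := by
        rw [Finset.sum_const, smul_eq_mul]
        exact Nat.mul_le_mul_right _ (Finset.card_le_univ _)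

lemma sum_card_badPoints_le (hl : ∀ v, (Finset.univ.filter fun p => l p = v).card ≤ d)
    (hN : 6 ≤ Fintype.card (J × Bool)) :
    ∑ σ : Perm (J × Bool), (badPoints (l ∘ σ)).card ≤
      (2 * d + 4 * d ^ 2) * (Fintype.card (J × Bool)).factorial := by
  refine Nat.le_of_mul_le_mul_left (c := Fintype.card (J × Bool)) ?_ (by lia)
  calc _ ≤ Fintype.card (J × Bool) * ∑ σ : Perm (J × Bool), ∑ x, ∑ y ∈ Finset.univ.erase x,
        if dart (l ∘ σ) y = dart (l ∘ σ) x then 1 else 0 :=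
        Nat.mul_le_mul_left _ (Finset.sum_le_sum fun σ _ => card_badPoints_le_sum _)
    _ = ∑ x, Fintype.card (J × Bool) * ∑ y ∈ Finset.univ.erase x, (Finset.univ.filter
        fun σ : Perm (J × Bool) => dart (l ∘ σ) y = dart (l ∘ σ) x).card := by
        simp only [Finset.card_filter, ← Finset.mul_sum]
        rw [Finset.sum_comm]
        exact congrArg _ (Finset.sum_congr rfl fun x _ => Finset.sum_comm)
    _ ≤ ∑ _x : J × Bool, (2 * d + 4 * d ^ 2) * (Fintype.card (J × Bool)).factorial :=
        Finset.sum_le_sum fun x _ => sum_card_filter_dart_eq_le hl hN x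
    _ = _ := by rw [Finset.sum_const, smul_eq_mul, Finset.card_univ]

end FirstMoment

section SimpleConfigurations

open Equiv

variable {J V : Type*} [Fintype J] [DecidableEq J] [DecidableEq V] {l : J × Bool → V} {d : ℕ}

lemma exists_card_badPoints_comp_mul_swap_le
    (hl : ∀ v, (Finset.univ.filter fun p => l p = v).card ≤ d) {k : ℕ}
    (hcard : d * (2 * d + 3) + (k + 1) < Fintype.card (J × Bool)) {σ : Perm (J × Bool)}
    (hσ : (badPoints (l ∘ σ)).card ≤ k + 1) :
    ∃ x z, (badPoints (l ∘ (σ * swap x z : Perm (J × Bool)))).card ≤ k := by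
  rcases (badPoints (l ∘ σ)).eq_empty_or_nonempty with h0 | ⟨x, hx⟩
  · obtain ⟨x⟩ : Nonempty (J × Bool) := Fintype.card_pos_iff.1 (by lia)
    exact ⟨x, x, by simp [h0]⟩
  · have hlσ (v) : (Finset.univ.filter fun p => (l ∘ σ) p = v).card ≤ d :=
      (Finset.card_le_card_of_injOn σ (fun p hp => by simpa using hp) σ.injective.injOn).trans
        (hl v)
    obtain ⟨z, hz⟩ := exists_card_badPoints_comp_swap_lt hlσ (by lia) hx
    exact ⟨x, z, Nat.le_of_lt_succ (hz.trans_le hσ)⟩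

lemma card_filter_card_badPoints_le_succ
    (hl : ∀ v, (Finset.univ.filter fun p => l p = v).card ≤ d) {k : ℕ}
    (hcard : d * (2 * d + 3) + (k + 1) < Fintype.card (J × Bool)) :
    (Finset.univ.filter fun σ : Perm (J × Bool) => (badPoints (l ∘ σ)).card ≤ k + 1).card ≤
      Fintype.card (J × Bool) ^ 2 * (Finset.univ.filter
        fun σ : Perm (J × Bool) => (badPoints (l ∘ σ)).card ≤ k).card := by
  have hsub : (Finset.univ.filter fun σ : Perm (J × Bool) => (badPoints (l ∘ σ)).card ≤ k + 1) ⊆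
      (Finset.univ : Finset ((J × Bool) × (J × Bool))).biUnion fun p =>
        (Finset.univ.filter fun σ : Perm (J × Bool) => (badPoints (l ∘ σ)).card ≤ k).image
          (· * swap p.1 p.2) := by
    intro σ hσ
    obtain ⟨x, z, h⟩ :=
      exists_card_badPoints_comp_mul_swap_le hl hcard ((Finset.mem_filter_univ σ).1 hσ)
    simp only [Finset.mem_biUnion, Finset.mem_univ, true_and, Finset.mem_image,
      Finset.mem_filter_univ]
    exact ⟨(x, z), σ * swap x z, h, mul_swap_mul_self x z σ⟩
  calc _ ≤ ∑ _p : (J × Bool) × (J × Bool), (Finset.univ.filter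
        fun σ : Perm (J × Bool) => (badPoints (l ∘ σ)).card ≤ k).card :=
        (Finset.card_le_card hsub).trans (Finset.card_biUnion_le.trans
          (Finset.sum_le_sum fun p _ => Finset.card_image_le))
    _ = _ := by rw [Finset.sum_const, smul_eq_mul, Finset.card_univ, Fintype.card_prod, sq]

lemma card_filter_card_badPoints_le
    (hl : ∀ v, (Finset.univ.filter fun p => l p = v).card ≤ d) {k : ℕ}
    (hcard : d * (2 * d + 3) + k < Fintype.card (J × Bool)) :
    (Finset.univ.filter fun σ : Perm (J × Bool) => (badPoints (l ∘ σ)).card ≤ k).card ≤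
      (Fintype.card (J × Bool) ^ 2) ^ k * (Finset.univ.filter
        fun σ : Perm (J × Bool) => Function.Injective (dart (l ∘ σ))).card := by
  induction k with
  | zero => simp [badPoints_eq_empty_iff]
  | succ k ih =>
    refine (card_filter_card_badPoints_le_succ hl hcard).trans ?_
    rw [pow_succ' _ k, mul_assoc]
    exact Nat.mul_le_mul_left _ (ih (by lia))

lemma factorial_le_two_mul_card_filter_card_badPoints_le
    (hl : ∀ v, (Finset.univ.filter fun p => l p = v).card ≤ d)
    (hN : 6 ≤ Fintype.card (J × Bool)) (hd : 1 ≤ d) :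
    (Fintype.card (J × Bool)).factorial ≤ 2 * (Finset.univ.filter
      fun σ : Perm (J × Bool) => (badPoints (l ∘ σ)).card ≤ 4 * d + 8 * d ^ 2).card := by
  set S := Finset.univ.filter
    fun σ : Perm (J × Bool) => (badPoints (l ∘ σ)).card ≤ 4 * d + 8 * d ^ 2
  set T := Finset.univ.filter
    fun σ : Perm (J × Bool) => ¬ (badPoints (l ∘ σ)).card ≤ 4 * d + 8 * d ^ 2
  have hST : S.card + T.card = (Fintype.card (J × Bool)).factorial := by
    rw [Finset.card_filter_add_card_filter_not, Finset.card_univ, Fintype.card_perm]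
  have hmarkov : T.card * (4 * d + 8 * d ^ 2) ≤
      (2 * d + 4 * d ^ 2) * (Fintype.card (J × Bool)).factorial :=
    calc _ ≤ ∑ σ ∈ T, (badPoints (l ∘ σ)).card :=
          Finset.card_nsmul_le_sum _ _ _ fun σ hσ => (not_le.1 (Finset.mem_filter.1 hσ).2).le
      _ ≤ ∑ σ : Perm (J × Bool), (badPoints (l ∘ σ)).card :=
          Finset.sum_le_sum_of_subset (Finset.filter_subset _ _)
      _ ≤ _ := sum_card_badPoints_le hl hN
  have hT : 2 * T.card ≤ (Fintype.card (J × Bool)).factorial :=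
    Nat.le_of_mul_le_mul_left (c := 2 * d + 4 * d ^ 2) (by linarith) (by positivity)
  lia

lemma factorial_le_mul_card_filter_injective_dart
    (hl : ∀ v, (Finset.univ.filter fun p => l p = v).card ≤ d) (hd : 1 ≤ d)
    (hcard : d * (2 * d + 3) + (4 * d + 8 * d ^ 2) < Fintype.card (J × Bool)) :
    (Fintype.card (J × Bool)).factorial ≤
      2 * (Fintype.card (J × Bool) ^ 2) ^ (4 * d + 8 * d ^ 2) * (Finset.univ.filter
        fun σ : Perm (J × Bool) => Function.Injective (dart (l ∘ σ))).card := by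
  rw [mul_assoc]
  exact (factorial_le_two_mul_card_filter_card_badPoints_le hl (by nlinarith) hd).trans
    (Nat.mul_le_mul_left 2 (card_filter_card_badPoints_le hl hcard))

end SimpleConfigurations

section DartGraph

open Equiv

variable {J V : Type*} {c c' : J × Bool → V}

/-- The simple graph that is left of the paired half-edges when loops are deleted and parallel edges
are identified. -/
def dartGraph (c : J × Bool → V) : SimpleGraph V :=
  SimpleGraph.fromEdgeSet (Set.range (pairEdge c))

lemma pairEdge_fst (c : J × Bool → V) (p : J × Bool) :
    pairEdge c p.1 = s((dart c p).1, (dart c p).2) := by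
  obtain ⟨j, _ | _⟩ := p
  · rfl
  · exact Sym2.eq_swap

lemma isDiag_pairEdge_fst_iff {p : J × Bool} :
    (pairEdge c p.1).IsDiag ↔ dart c (oppEnd p) = dart c p := by
  rw [pairEdge_fst, Sym2.mk_isDiag_iff, dart_oppEnd]
  exact ⟨fun h => Prod.ext h.symm h, fun h => (congrArg Prod.snd h)⟩

lemma pairEdge_fst_eq_iff {p p' : J × Bool} :
    pairEdge c p.1 = pairEdge c p'.1 ↔ dart c p = dart c p' ∨ dart c p = dart c (oppEnd p') := by
  rw [pairEdge_fst, pairEdge_fst, Sym2.mk_eq_mk_iff, dart_oppEnd]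

lemma injective_dart_iff : Function.Injective (dart c) ↔
    Function.Injective (pairEdge c) ∧ ∀ j, ¬ (pairEdge c j).IsDiag := by
  refine ⟨fun h => ⟨fun i j hij => ?_, fun j hj => ?_⟩, fun ⟨hinj, hdiag⟩ p p' h => ?_⟩
  · rcases pairEdge_fst_eq_iff (p := (i, false)) (p' := (j, false)).1 hij with h' | h' <;>
      exact congrArg Prod.fst (h h')
  · exact oppEnd_ne_self _ (h (isDiag_pairEdge_fst_iff (p := (j, false)).1 hj))
  · have hfst : p.1 = p'.1 := hinj (pairEdge_fst_eq_iff.2 (.inl h))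
    by_contra hne
    have hsnd : p = oppEnd p' := Prod.ext hfst (Bool.eq_not.2 fun h => hne (Prod.ext hfst h))
    exact hdiag _ (isDiag_pairEdge_fst_iff.2 (hsnd ▸ h))

lemma dartGraph_adj (hc : Function.Injective (dart c)) {v w : V} :
    (dartGraph c).Adj v w ↔ ∃ p, dart c p = (v, w) := by
  rw [dartGraph, SimpleGraph.fromEdgeSet_adj]
  constructor
  · rintro ⟨⟨j, hj⟩, -⟩
    rcases Sym2.mk_eq_mk_iff (p := dart c (j, false)) (q := (v, w)).1 hj with h | h
    · exact ⟨_, h⟩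
    · exact ⟨oppEnd (j, false), by rw [dart_oppEnd, h, Prod.swap_swap]⟩
  · rintro ⟨p, hp⟩
    have hedge : pairEdge c p.1 = s(v, w) := by rw [pairEdge_fst, hp]
    refine ⟨⟨p.1, hedge⟩, fun hvw => (injective_dart_iff.1 hc).2 p.1 ?_⟩
    rw [hedge]
    exact hvw

lemma pairedGraph_eq_toMultigraph [Fintype J] [Finite V] (hc : Function.Injective (dart c)) :
    pairedGraph c = (dartGraph c).toMultigraph := by
  obtain ⟨hinj, hdiag⟩ := injective_dart_iff.1 hc
  have hedges : (dartGraph c).edgeSet.toFinite.toFinset = Finset.univ.map ⟨_, hinj⟩ := by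
    ext e
    simp only [dartGraph, SimpleGraph.edgeSet_fromEdgeSet, Set.Finite.mem_toFinset, Set.mem_sdiff,
      Set.mem_range, Finset.mem_map, Finset.mem_univ, true_and, Function.Embedding.coeFn_mk]
    exact ⟨And.left, fun ⟨j, hj⟩ => ⟨⟨j, hj⟩, hj ▸ hdiag j⟩⟩
  rw [SimpleGraph.toMultigraph, hedges]
  rfl

lemma degree_dartGraph [Fintype J] [DecidableEq V] (hc : Function.Injective (dart c)) (v : V)
    [Fintype ((dartGraph c).neighborSet v)] :
    (dartGraph c).degree v = (Finset.univ.filter fun p => c p = v).card := by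
  have hneighbor : (dartGraph c).neighborFinset v =
      (Finset.univ.filter fun p => c p = v).image fun p => c (oppEnd p) := by
    ext w
    simp [dartGraph_adj hc, dart]
  rw [← SimpleGraph.card_neighborFinset_eq_degree, hneighbor, Finset.card_image_of_injOn]
  intro p hp p' hp' h
  simp only [Finset.coe_filter_univ, Set.mem_ofPred_eq] at hp hp'
  exact hc (Prod.ext (hp.trans hp'.symm) h)

lemma exists_dartGraph_eq {G : SimpleGraph V} (θ : J ≃ G.edgeSet) :
    ∃ c : J × Bool → V, Function.Injective (dart c) ∧ dartGraph c = G := by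
  obtain ⟨c, hc⟩ := exists_pairEdge_eq fun j => (θ j).1
  have hrange : Set.range (pairEdge c) = G.edgeSet := by
    rw [hc]
    exact (θ.surjective.range_comp Subtype.val).trans Subtype.range_val
  refine ⟨c, injective_dart_iff.2 ⟨?_, fun j => ?_⟩, ?_⟩
  · rw [hc]
    exact Subtype.val_injective.comp θ.injective
  · rw [hc]
    exact G.not_isDiag_of_mem_edgeSet (θ j).2
  · rw [dartGraph, hrange, SimpleGraph.fromEdgeSet_edgeSet]

lemma dart_comp_of_commute {ρ : J × Bool → J × Bool} (hρ : ∀ p, ρ (oppEnd p) = oppEnd (ρ p)) :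
    dart (c ∘ ρ) = dart c ∘ ρ := by
  funext p
  simp [dart, hρ]

lemma dartGraph_comp_perm (hc : Function.Injective (dart c)) {ρ : Perm (J × Bool)}
    (hρ : ∀ p, ρ (oppEnd p) = oppEnd (ρ p)) : dartGraph (c ∘ ρ) = dartGraph c := by
  have hcρ : Function.Injective (dart (c ∘ ρ)) := by
    rw [dart_comp_of_commute hρ]
    exact hc.comp ρ.injective
  ext v w
  rw [dartGraph_adj hcρ, dartGraph_adj hc, dart_comp_of_commute hρ]
  exact (ρ.surjective.exists (p := fun p => dart c p = (v, w))).symm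

lemma exists_perm_comp_eq_of_dartGraph_eq (hc : Function.Injective (dart c))
    (hc' : Function.Injective (dart c')) (h : dartGraph c' = dartGraph c) :
    ∃ ρ : Perm (J × Bool), (∀ p, ρ (oppEnd p) = oppEnd (ρ p)) ∧ c ∘ ρ = c' := by
  have hrange : Set.range (dart c') = Set.range (dart c) := by
    ext ⟨v, w⟩
    rw [Set.mem_range, ← dartGraph_adj hc', h, dartGraph_adj hc, Set.mem_range]
  let ρ : Perm (J × Bool) := (ofInjective _ hc').trans
    ((setCongr hrange).trans (ofInjective _ hc).symm)
  have hρ (p) : dart c (ρ p) = dart c' p := by simp [ρ, apply_ofInjective_symm]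
  refine ⟨ρ, fun p => hc ?_, funext fun p => congrArg Prod.fst (hρ p)⟩
  rw [hρ, dart_oppEnd, dart_oppEnd, hρ]

end DartGraph

section RegularGraphs

open Equiv

variable {J V : Type*} [Fintype J] [DecidableEq V] {l : J × Bool → V} {d : ℕ}

open Classical in
lemma card_filter_dartGraph_eq [DecidableEq J] {τ : Perm (J × Bool)}
    (hτ : Function.Injective (dart (l ∘ τ))) :
    (Finset.univ.filter fun σ : Perm (J × Bool) =>
      Function.Injective (dart (l ∘ σ)) ∧ dartGraph (l ∘ σ) = dartGraph (l ∘ τ)).card =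
      ((Finset.univ.filter fun κ : Perm (J × Bool) => l ∘ κ = l) ×ˢ
        Finset.univ.filter fun ρ : Perm (J × Bool) =>
          ∀ p, ρ (oppEnd p) = oppEnd (ρ p)).card := by
  have hcomp {κ ρ : Perm (J × Bool)} (hκ : l ∘ κ = l) : l ∘ ⇑(κ * τ * ρ) = (l ∘ τ) ∘ ρ :=
    congrArg (fun f => (f ∘ τ) ∘ ρ) hκ
  refine (Finset.card_bij (fun x _ => x.1 * τ * x.2) ?_ ?_ ?_).symm
  · rintro ⟨κ, ρ⟩ hx
    simp only [Finset.mem_product, Finset.mem_filter_univ] at hx ⊢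
    rw [hcomp hx.1]
    exact ⟨dart_comp_of_commute hx.2 ▸ hτ.comp ρ.injective, dartGraph_comp_perm hτ hx.2⟩
  · rintro ⟨κ, ρ⟩ hx ⟨κ', ρ'⟩ hx' h
    simp only [Finset.mem_product, Finset.mem_filter_univ] at hx hx' h
    have hdart : dart (l ∘ τ) ∘ ρ = dart (l ∘ τ) ∘ ρ' := by
      rw [← dart_comp_of_commute hx.2, ← dart_comp_of_commute hx'.2, ← hcomp hx.1, ← hcomp hx'.1, h]
    obtain rfl : ρ = ρ' := DFunLike.coe_injective (hτ.comp_left hdart)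
    exact Prod.ext (mul_right_cancel (mul_right_cancel h)) rfl
  · intro σ hσ
    obtain ⟨hσ, hgraph⟩ := (Finset.mem_filter_univ σ).1 hσ
    obtain ⟨ρ, hρ, hcompρ⟩ := exists_perm_comp_eq_of_dartGraph_eq hτ hσ hgraph
    refine ⟨(σ * ρ⁻¹ * τ⁻¹, ρ), ?_, by group⟩
    simp only [Finset.mem_product, Finset.mem_filter_univ]
    refine ⟨funext fun p => ?_, hρ⟩
    simpa using (congrFun hcompρ (ρ⁻¹ (τ⁻¹ p))).symm

lemma exists_perm_comp_eq_of_card_fiber_eq {X : Type*} [Fintype X] {f g : X → V}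
    (h : ∀ v, (Finset.univ.filter fun x => f x = v).card =
      (Finset.univ.filter fun x => g x = v).card) :
    ∃ σ : Perm X, g ∘ σ = f := by
  simp only [← Fintype.card_subtype] at h
  refine ⟨(sigmaFiberEquiv f).symm.trans ((sigmaCongrRight fun v =>
    Fintype.equivOfCardEq (h v)).trans (sigmaFiberEquiv g)), funext fun x => ?_⟩
  exact ((Fintype.equivOfCardEq (h (f x))) ⟨x, rfl⟩).2

variable [Fintype V]

open Classical in
lemma nonempty_equiv_edgeSet (hl : ∀ v, (Finset.univ.filter fun p => l p = v).card = d)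
    {G : SimpleGraph V} (hG : G.IsRegularOfDegree d) : Nonempty (J ≃ G.edgeSet) := by
  have hsum : ∑ v, (Finset.univ.filter fun p => l p = v).card = ∑ v, G.degree v :=
    Finset.sum_congr rfl fun v _ => (hl v).trans (hG v).symm
  rw [← Finset.card_eq_sum_card_fiberwise (fun p _ => Finset.mem_univ _),
    G.sum_degrees_eq_twice_card_edges, Finset.card_univ, Fintype.card_prod, Fintype.card_bool,
    SimpleGraph.edgeFinset_card] at hsum
  exact ⟨Fintype.equivOfCardEq (by lia)⟩

open Classical in
lemma exists_perm_dartGraph_eq (hl : ∀ v, (Finset.univ.filter fun p => l p = v).card = d)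
    {G : SimpleGraph V} (hG : G.IsRegularOfDegree d) :
    ∃ τ : Perm (J × Bool), Function.Injective (dart (l ∘ τ)) ∧ dartGraph (l ∘ τ) = G := by
  obtain ⟨θ⟩ := nonempty_equiv_edgeSet hl hG
  obtain ⟨c, hc, rfl⟩ := exists_dartGraph_eq θ
  obtain ⟨τ, rfl⟩ := exists_perm_comp_eq_of_card_fiber_eq (f := c) (g := l) fun v => by
    rw [hl, ← degree_dartGraph hc v, hG v]
  exact ⟨τ, hc, rfl⟩

open Classical in
lemma isRegularOfDegree_dartGraph (hl : ∀ v, (Finset.univ.filter fun p => l p = v).card = d)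
    {σ : Perm (J × Bool)} (hσ : Function.Injective (dart (l ∘ σ))) :
    (dartGraph (l ∘ σ)).IsRegularOfDegree d := fun v => by
  rw [degree_dartGraph hσ, ← hl v]
  exact Finset.card_equiv σ fun p => by simp

open Classical in
lemma uniformLaw_injective_dart_eq [DecidableEq J]
    (hl : ∀ v, (Finset.univ.filter fun p => l p = v).card = d) {Ω : Type*} [MeasurableSpace Ω]
    (f : SimpleGraph V → Ω) :
    uniformLaw (Finset.univ.filter fun σ : Perm (J × Bool) => Function.Injective (dart (l ∘ σ)))
        (fun σ => f (dartGraph (l ∘ σ))) =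
      uniformLaw (Finset.univ.filter fun G : SimpleGraph V => G.IsRegularOfDegree d) f := by
  refine uniformLaw_comp_of_card_fiber_eq f (c := (
    (Finset.univ.filter fun κ : Perm (J × Bool) => l ∘ κ = l) ×ˢ
      Finset.univ.filter fun ρ : Perm (J × Bool) => ∀ p, ρ (oppEnd p) = oppEnd (ρ p)).card)
    ?_ (fun σ hσ => ?_) fun G hG => ?_
  · exact Finset.card_ne_zero_of_mem (a := (1, 1)) (by simp)
  · simpa using isRegularOfDegree_dartGraph hl ((Finset.mem_filter_univ σ).1 hσ)
  · obtain ⟨τ, hτ, rfl⟩ := exists_perm_dartGraph_eq hl ((Finset.mem_filter_univ G).1 hG)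
    rw [Finset.filter_filter]
    exact card_filter_dartGraph_eq hτ

end RegularGraphs

section RandomRegularGraph

open Equiv

variable {d n m : ℕ}

lemma card_filter_fst_equiv_eq {X : Type*} [Fintype X] (e : X ≃ Fin n × Fin d) (v : Fin n) :
    (Finset.univ.filter fun p => (Prod.fst ∘ e) p = v).card = d := by
  have himage : (Finset.univ.filter fun p => (Prod.fst ∘ e) p = v).map e.toEmbedding =
      {v} ×ˢ (Finset.univ : Finset (Fin d)) := by
    ext ⟨w, i⟩
    simp [Finset.mem_map_equiv, eq_comm]
  rw [← Finset.card_map e.toEmbedding, himage]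
  simp

open Classical in
lemma regularGraph_eq_uniformLaw (d n : ℕ) :
    regularGraph d n = uniformLaw
      (Finset.univ.filter fun G : SimpleGraph (Fin n) => G.IsRegularOfDegree d) id := by
  ext A hA
  have hreg : {G : SimpleGraph (Fin n) | G.IsRegularOfDegree d} =
      (Finset.univ.filter fun G : SimpleGraph (Fin n) => G.IsRegularOfDegree d) := by simp
  have hAset : A = (Finset.univ.filter fun G => G ∈ A : Finset (SimpleGraph (Fin n))) := by simp
  rw [uniformLaw_apply hA, regularGraph, hreg]
  conv_lhs => rw [hAset]
  rw [uniformOn_apply_finset, Finset.inter_filter, Finset.inter_univ, ENNReal.div_eq_inv_mul]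
  rfl

open Classical in
lemma map_regularGraph_eq_uniformLaw {J : Type*} [Fintype J] [DecidableEq J]
    (e : J × Bool ≃ Fin n × Fin d) :
    (regularGraph d n).map SimpleGraph.toMultigraph =
      uniformLaw (Finset.univ.filter fun σ : Perm (J × Bool) =>
          Function.Injective (dart ((Prod.fst ∘ e) ∘ σ)))
        fun σ => pairedGraph ((Prod.fst ∘ e) ∘ σ) := by
  rw [regularGraph_eq_uniformLaw, map_uniformLaw .of_discrete]
  simp only [id]
  rw [← uniformLaw_injective_dart_eq (card_filter_fst_equiv_eq e)]
  refine uniformLaw_congr fun σ hσ => ?_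
  exact (pairedGraph_eq_toMultigraph ((Finset.mem_filter_univ σ).1 hσ)).symm

lemma configurationModel_eq_uniformLaw (e : Fin m × Bool ≃ Fin n × Fin d) :
    configurationModel d n m =
      uniformLaw Finset.univ fun σ : Perm (Fin m × Bool) => pairedGraph ((Prod.fst ∘ e) ∘ σ) := by
  rw [configurationModel_eq_map_perm e.toEmbedding, map_uniformLaw .of_discrete,
    ← uniformLaw_univ_equiv e.permCongr]
  simp [Function.comp_def]

open Classical in
lemma factorial_le_mul_card_filter_injective_dart_fst (hd : 1 ≤ d)
    (e : Fin m × Bool ≃ Fin n × Fin d) (hn : d * (2 * d + 3) + (4 * d + 8 * d ^ 2) < n * d) :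
    (n * d).factorial ≤ 2 * ((n * d) ^ 2) ^ (4 * d + 8 * d ^ 2) *
      (Finset.univ.filter fun σ : Perm (Fin m × Bool) =>
        Function.Injective (dart ((Prod.fst ∘ e) ∘ σ))).card := by
  have hcard : Fintype.card (Fin m × Bool) = n * d := by simp [Fintype.card_congr e]
  rw [← hcard] at hn ⊢
  convert factorial_le_mul_card_filter_injective_dart
    (fun v => (card_filter_fst_equiv_eq e v).le) hd hn

lemma isProbabilityMeasure_map_regularGraph (hd : 1 ≤ d) (e : Fin m × Bool ≃ Fin n × Fin d)
    (hn : d * (2 * d + 3) + (4 * d + 8 * d ^ 2) < n * d) :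
    IsProbabilityMeasure ((regularGraph d n).map SimpleGraph.toMultigraph) := by
  rw [map_regularGraph_eq_uniformLaw e]
  refine isProbabilityMeasure_uniformLaw _ (Finset.card_pos.1 (Nat.pos_of_ne_zero fun h => ?_))
  have hle := factorial_le_mul_card_filter_injective_dart_fst hd e hn
  rw [h, mul_zero] at hle
  exact absurd hle (Nat.factorial_pos _).not_ge

lemma measureReal_map_regularGraph_le (hd : 1 ≤ d) (e : Fin m × Bool ≃ Fin n × Fin d)
    (hn : d * (2 * d + 3) + (4 * d + 8 * d ^ 2) < n * d) (A : Set (Multigraph (Fin n))) :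
    ((regularGraph d n).map SimpleGraph.toMultigraph).real A ≤
      2 * ((n * d : ℝ) ^ 2) ^ (4 * d + 8 * d ^ 2) * (configurationModel d n m).real A := by
  classical
  rw [map_regularGraph_eq_uniformLaw e, configurationModel_eq_uniformLaw e]
  refine measureReal_uniformLaw_le_of_subset _ (Finset.subset_univ _) ?_ .of_discrete
  rw [Finset.card_univ, Fintype.card_perm, Fintype.card_congr e, Fintype.card_prod,
    Fintype.card_fin, Fintype.card_fin]
  exact_mod_cast factorial_le_mul_card_filter_injective_dart_fst hd e hn

lemma nonempty_halfEdge_equiv (h : Even (d * n)) :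
    Nonempty (Fin (d * n / 2) × Bool ≃ Fin n × Fin d) :=
  ⟨Fintype.equivOfCardEq (by simp [mul_comm _ 2, Nat.two_mul_div_two_of_even h, mul_comm n d])⟩

lemma exponentiallySmall_regularGraph {q : ℕ} (hq : 1 ≤ q) {δ β : ℝ} (hδ : 0 < δ) (hβ : 0 ≤ β)
    (hd : 1 ≤ d) :
    ExponentiallySmall (atTop ⊓ 𝓟 {n : ℕ | Even (d * n)}) fun n =>
      deviationProb (regularGraph d n) (fun G => G.toMultigraph.logZ q β) (δ * n) := by
  have hlarge : ∀ᶠ n : ℕ in atTop ⊓ 𝓟 {n : ℕ | Even (d * n)},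
      d * (2 * d + 3) + (4 * d + 8 * d ^ 2) < n * d ∧
        Nonempty (Fin (d * n / 2) × Bool ≃ Fin n × Fin d) := by
    rw [eventually_inf_principal]
    filter_upwards [eventually_gt_atTop (d * (2 * d + 3) + (4 * d + 8 * d ^ 2))] with n hn heven
    exact ⟨hn.trans_le (Nat.le_mul_of_pos_right n hd), nonempty_halfEdge_equiv heven⟩
  simp only [← deviationProb_map (f := SimpleGraph.toMultigraph)
    (X := Multigraph.logZ q β) .of_discrete .of_discrete]
  refine exponentiallySmall_deviationProb_of_measureReal_le inf_le_left
    (ν := fun n => configurationModel d n (d * n / 2)) (fun n => .of_discrete)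
    (a := fun n => (⟨0⟩ : Multigraph (Fin n)).logZ q β) (C := β * (d / 2))
    (K := 2 * ((d : ℝ) ^ 2) ^ (4 * d + 8 * d ^ 2)) (k := 2 * (4 * d + 8 * d ^ 2))
    (by positivity) (by positivity) ?_ ?_ ?_ (fun s hs => ?_) hδ
  · filter_upwards [hlarge] with n ⟨hn, ⟨e⟩⟩
    exact isProbabilityMeasure_map_regularGraph hd e hn
  · filter_upwards [hlarge] with n ⟨_, ⟨e⟩⟩
    refine ⟨isProbabilityMeasure_configurationModel e.toEmbedding, ?_⟩
    have hm : ((d * n / 2 : ℕ) : ℝ) ≤ d * n / 2 := by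
      exact_mod_cast (Nat.cast_div_le (m := d * n) (n := 2) : _ ≤ ((d * n : ℕ) : ℝ) / (2 : ℕ))
    filter_upwards [ae_configurationModel_abs_logZ_sub_le hq hβ d n (d * n / 2)] with G hG
    linarith [mul_le_mul_of_nonneg_left hm hβ]
  · filter_upwards [hlarge] with n ⟨hn, ⟨e⟩⟩ A _
    refine (measureReal_map_regularGraph_le hd e hn A).trans_eq ?_
    rw [pow_mul, mul_pow, mul_pow]
    ring
  · refine exponentiallySmall_deviationProb_of_hasLocalMGFBound inf_le_left
      (r := 4 * β) (by positivity) (v := d * (4 * β) ^ 2) (by positivity) ?_ hs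
    filter_upwards [hlarge] with n ⟨_, ⟨e⟩⟩
    exact ⟨isProbabilityMeasure_configurationModel e.toEmbedding,
      hasLocalMGFBound_configurationModel hq hβ e.toEmbedding⟩

end RandomRegularGraph

theorem proposition2p1 (q : ℕ) (hq : 1 ≤ q) (ε δ β : ℝ) (hε : 0 < ε) (hε1 : ε ≤ 1)
    (hδ : 0 < δ) (hβ : 0 < β) :
    (∀ d : ℝ, 0 < d → ∃ ξ : ℝ, 0 < ξ ∧ ∀ᶠ n : ℕ in atTop,
      deviationProb (binomialGraph d n) (fun G => G.toMultigraph.logZ q β) (δ * n)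
          ≤ Real.exp (-ξ * n) ∧
      deviationProb (sparsifiedBinomial ε d n) (fun G => G.logZ q β) (δ * n)
          ≤ Real.exp (-ξ * n)) ∧
    (∀ d : ℕ, 1 ≤ d → ∃ ξ : ℝ, 0 < ξ ∧ ∀ᶠ n : ℕ in atTop,
      (Even (d * n) →
        deviationProb (regularGraph d n) (fun G => G.toMultigraph.logZ q β) (δ * n)
          ≤ Real.exp (-ξ * n)) ∧
      deviationProb (sparsifiedRegular ε d n) (fun G => G.logZ q β) (δ * n)
          ≤ Real.exp (-ξ * n)) := by
  refine ⟨fun d hd => ?_, fun d hd => ?_⟩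
  · obtain ⟨ξ, hξ, hgraph, hsparse⟩ := (exponentiallySmall_binomialGraph hq hδ hβ.le hd)
      |>.exists_common_rate (exponentiallySmall_sparsifiedBinomial hq hε hε1 hδ hβ.le hd)
    exact ⟨ξ, hξ, hgraph.and hsparse⟩
  · obtain ⟨ξ, hξ, hgraph, hsparse⟩ := (exponentiallySmall_regularGraph hq hδ hβ.le hd)
      |>.exists_common_rate (exponentiallySmall_sparsifiedRegular hq hε hε1 hδ hβ.le hd)
    exact ⟨ξ, hξ, (eventually_inf_principal.1 hgraph).and hsparse⟩
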